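/- Let $q$ be an odd prime power, let $c\in\mathbb F_q$ be a non-square, and let $S=\{0,\infty\}\cup S_0$ with $S_0\subseteq\mathbb F_q^\times$ be a finite set of $\mathbb F_q$-rational places of $K=\mathbb F_q(t)$. Let $\mathfrak o_{K,S}\subseteq K$ be the ring of functions that are regular outside $S$, and let $$\Lambda_S=\big(\mathfrak o_{K,S}\{Z,F\}/(Z^2=c,\ F^2=t,\ ZF+FZ=0)\big)^\times/\,\mathfrak o_{K,S}^\times ,$$ writing $[w]$ for the class of a unit $w$. Put $B=\{0,\infty\}$ and let $\Lambda_B\to\Lambda_S$ be the natural map. Let $\mathbb F_q[Z]=\mathbb F_q\oplus\mathbb F_qZ$, a field with $q^2$ elements, with conjugation $\alpha\mapsto\bar\alpha$ over $\mathbb F_q$ and norm $N(\alpha)=\alpha\bar\alpha$. For $\tau\in S_0$ let $PA_\tau=\{[1+\alpha F] : \alpha\in\mathbb F_q[Z],\ N(\alpha)=\tau^{-1}\}\subseteq\Lambda_S$, and let $\Gamma_S\subseteq\Lambda_S$ be the subgroup generated by $\bigcup_{\tau\in S_0}PA_\tau$. Fix a generator $\delta$ of $\mathbb F_q[Z]^\times$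 and put $d=[\delta]$, $s=[F]$. For $\tau\in S_0$ let $a_\tau=[1+\alpha_0F]\in PA_\tau$, where $\alpha_0\in\mathbb F_q$ with $\alpha_0^2=\tau^{-1}$ if $\tau$ is a square in $\mathbb F_q$, and $\alpha_0=\alpha_1\delta^{-1}$ with $\alpha_1\in\mathbb F_q$, $\alpha_1^2=N(\delta)\tau^{-1}$ if $\tau$ is not a square (the square roots being chosen arbitrarily). For $\alpha,\beta\in\mathbb F_q[Z]^\times$ with $N(\alpha)\ne N(\beta)$ put $$\zeta_\alpha(\beta)=\frac{1+\alpha/\beta}{1+\bar\alpha/\bar\beta}.$$ Then $\Lambda_B\to\Lambda_S$ is injective and, identifying $\Lambda_B$ with its image, $\Lambda_S$ is the semidirect product $\Gamma_S\rtimes\Lambda_B$, where $\Gamma_S$ is normal of index $2(q+1)$. For all $\tau\in S_0$ we have $PA_\tau=\{d^ia_\tau d^{-i} : 0\le i\le q\}$. Moreover, $\Lambda_S$ has the presentation with generators $d$, $s$ and $a_\tau$ ($\tau\in S_0$), subject to the relations (I) $d^{q+1}=s^2=(sd)^2=1$, and $(d^{(q+1)/2}a_\tau)^2=1$ for all $\tau\in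 S_0$; (II) for all $\tau\in S_0$: $a_\tau=sa_\tau s$ if $\tau$ is a square in $\mathbb F_q$, and $a_\tau=(sd)a_\tau(sd)^{-1}$ if $\tau$ is not a square in $\mathbb F_q$; (III) for all $\tau\ne\sigma$ in $S_0$, $[1+\alpha F]\in PA_\tau$ and $[1+\beta F]\in PA_\sigma$: $$[1+\alpha F]\cdot[1+\beta F]=[1+\zeta_\alpha(\beta)\beta F]\cdot[1+\zeta_\beta(\alpha)\alpha F],$$ where each factor, an element of some $PA_\rho$ with $\rho\in\{\tau,\sigma\}$, is written as a word $d^ia_\rho d^{-i}$ with $0\le i\le q$. -/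

import Mathlib

open Polynomial
open scoped Quaternion

noncomputable section

namespace QuatLattice

/-! ### Rings of `S`-integers in the rational function field -/

section Integers

variable {F : Type*} [Field F]

/-- The places of `F(t)` in `S = {0, ∞} ∪ S₀` other than `∞`, as maximal ideals of `F[t]`: the place
`t = 0` and the places `t = τ` for `τ ∈ S₀`. -/
def places (S₀ : Finset Fˣ) : Set (IsDedekindDomain.HeightOneSpectrum F[X]) :=
  {v | v.asIdeal = Ideal.span {X} ∨ ∃ τ ∈ S₀, v.asIdeal = Ideal.span {X - C (τ : F)}}

/-- The ring of `S`-integers of `F(t)` for `S = {0, ∞} ∪ S₀`, i.e. the rational functions that are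
regular at every place outside `S`. (The place `∞` is the only place of `F(t)` that is not a
maximal ideal of `F[t]`, and it lies in `S`.) -/
abbrev SInt (S₀ : Finset Fˣ) : Type _ := (places S₀).integer (RatFunc F)

/-- The coordinate `t` of the projective line, as an `S`-integer. -/
def tt (S₀ : Finset Fˣ) : SInt S₀ := algebraMap F[X] (SInt S₀) X

/-- The constant function `a`, as an `S`-integer. -/
def const (S₀ : Finset Fˣ) : F →+* SInt S₀ := (algebraMap F[X] (SInt S₀)).comp C

lemma isUnit_algebraMap_of_irreducible (S₀ : Finset Fˣ) {p : F[X]} (hp : Irreducible p)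
    (h : ∀ v : IsDedekindDomain.HeightOneSpectrum F[X],
      v.asIdeal = Ideal.span {p} → v ∈ places S₀) :
    IsUnit (algebraMap F[X] (SInt S₀) p) := by
  have hp0 : algebraMap F[X] (RatFunc F) p ≠ 0 := by
    simpa using hp.ne_zero
  have hval : ∀ v : IsDedekindDomain.HeightOneSpectrum F[X], v ∉ places S₀ →
      v.valuation (RatFunc F) (algebraMap F[X] (RatFunc F) p) = 1 := by
    intro v hv
    rw [IsDedekindDomain.HeightOneSpectrum.valuation_eq_one_iff_notMem]
    intro hmem
    apply hv
    apply h
    have hmax : (Ideal.span {p}).IsMaximal := PrincipalIdealRing.isMaximal_of_irreducible hp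
    refine (hmax.eq_of_le v.isPrime.ne_top ?_).symm
    rwa [Ideal.span_singleton_le_iff_mem]
  refine IsUnit.of_mul_eq_one
    (⟨(algebraMap F[X] (RatFunc F) p)⁻¹, fun v hv => ?_⟩ : SInt S₀) ?_
  · rw [map_inv₀, hval v hv, inv_one]
  · apply Subtype.ext
    exact mul_inv_cancel₀ hp0

lemma isUnit_tt (S₀ : Finset Fˣ) : IsUnit (tt S₀) :=
  isUnit_algebraMap_of_irreducible S₀ Polynomial.irreducible_X fun _ hv => Or.inl hv

lemma isUnit_const (S₀ : Finset Fˣ) (a : Fˣ) : IsUnit (const S₀ (a : F)) :=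
  a.isUnit.map (const S₀)

lemma isUnit_tt_sub (S₀ : Finset Fˣ) (τ : S₀) :
    IsUnit (tt S₀ - const S₀ ((τ : Fˣ) : F)) := by
  have h := isUnit_algebraMap_of_irreducible S₀ (Polynomial.irreducible_X_sub_C ((τ : Fˣ) : F))
    fun _ hv => Or.inr ⟨τ, τ.2, hv⟩
  rwa [map_sub] at h

lemma places_mono {T₀ S₀ : Finset Fˣ} (h : T₀ ⊆ S₀) : places T₀ ⊆ places S₀ := by
  rintro v (hv | ⟨τ, hτ, hv⟩)
  · exact Or.inl hv
  · exact Or.inr ⟨τ, h hτ, hv⟩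

/-- The inclusion of the `T`-integers into the `S`-integers for `T ⊆ S`. -/
def inclInt {T₀ S₀ : Finset Fˣ} (h : T₀ ⊆ S₀) : SInt T₀ →+* SInt S₀ :=
  (Subalgebra.inclusion (S := (places T₀).integer (RatFunc F))
    (T := (places S₀).integer (RatFunc F))
    (fun _ hx v hv => hx v fun hv' => hv (places_mono h hv'))).toRingHom

end Integers

/-! ### The quaternion order and its projective unit group -/

section Order

variable {F : Type*} [Field F]

/-- The order `o_S{Z, F} / (Z² = c, F² = t, ZF + FZ = 0)` over the ring of `S`-integers: here `Z`
and `F` are the standard quaternion generators `i` and `j`, and `k = ZF`. -/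
abbrev Ord (c : F) (S₀ : Finset Fˣ) : Type _ := ℍ[SInt S₀, const S₀ c, 0, tt S₀]

/-- The image of the scalar units `o_Sˣ` in the unit group of the order. -/
def scalars (c : F) (S₀ : Finset Fˣ) : Subgroup (Ord c S₀)ˣ :=
  (Units.map (algebraMap (SInt S₀) (Ord c S₀)).toMonoidHom).range

instance scalars_normal (c : F) (S₀ : Finset Fˣ) : (scalars c S₀).Normal := by
  constructor
  rintro _ ⟨u, rfl⟩ g
  refine ⟨u, ?_⟩
  rw [eq_mul_inv_iff_mul_eq]
  ext1
  exact Algebra.commutes _ _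

/-- The group `Λ_S`: units of the quaternion order modulo the scalar units. -/
abbrev Lam (c : F) (S₀ : Finset Fˣ) : Type _ := (Ord c S₀)ˣ ⧸ scalars c S₀

/-- The class `[u] ∈ Λ_S` of a unit `u` of the order. -/
def cls (c : F) (S₀ : Finset Fˣ) : (Ord c S₀)ˣ →* Lam c S₀ := QuotientGroup.mk' (scalars c S₀)

/-- The inclusion of quaternion orders for `T ⊆ S`, coefficientwise. -/
def inclOrd (c : F) {T₀ S₀ : Finset Fˣ} (h : T₀ ⊆ S₀) : Ord c T₀ →+* Ord c S₀ where
  toFun w := ⟨inclInt h w.re, inclInt h w.imI, inclInt h w.imJ, inclInt h w.imK⟩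
  map_one' := by ext <;> simp
  map_zero' := by ext <;> simp
  map_add' x y := by ext <;> simp
  map_mul' x y := by
    have hc : inclInt h (const T₀ c) = const S₀ c := rfl
    have ht : inclInt h (tt T₀) = tt S₀ := rfl
    ext <;> simp [hc, ht]

/-- The natural homomorphism `Λ_T → Λ_S` for `T ⊆ S`. -/
def inclLam (c : F) {T₀ S₀ : Finset Fˣ} (h : T₀ ⊆ S₀) : Lam c T₀ →* Lam c S₀ :=
  QuotientGroup.map (scalars c T₀) (scalars c S₀) (Units.map (inclOrd c h).toMonoidHom) (by
    rintro _ ⟨u, rfl⟩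
    refine ⟨Units.map (inclInt h).toMonoidHom u, ?_⟩
    ext1
    ext <;> simp [inclOrd, QuaternionAlgebra.algebraMap_eq])

/-- An element of a quaternion algebra `(a, b)` with invertible reduced norm is a unit. -/
lemma isUnit_of_nrd {R : Type*} [CommRing R] {a b : R} (w : ℍ[R, a, 0, b])
    (h : IsUnit (w.re ^ 2 - a * w.imI ^ 2 - b * w.imJ ^ 2 + a * b * w.imK ^ 2)) : IsUnit w := by
  have e : w * star w = algebraMap R ℍ[R, a, 0, b]
      (w.re ^ 2 - a * w.imI ^ 2 - b * w.imJ ^ 2 + a * b * w.imK ^ 2) := by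
    ext <;> simp [QuaternionAlgebra.algebraMap_eq] <;> ring
  have hu : IsUnit (w * star w) := e ▸ h.map (algebraMap R ℍ[R, a, 0, b])
  have hc : Commute w (star w) := (IsStarNormal.star_comm_self (x := w)).symm
  exact (hc.isUnit_mul_iff.mp hu).1

/-- The quadratic extension `F[Z] = F ⊕ F·Z` of `F`, with `Z² = c`. Its conjugation is `star` and
its norm is `QuadraticAlgebra.norm`. -/
abbrev FZ (c : F) : Type _ := QuadraticAlgebra F c 0

/-- `F[Z]` as a subring of the quaternion order. -/
def emb (c : F) (S₀ : Finset Fˣ) : FZ c →+* Ord c S₀ where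
  toFun α := ⟨const S₀ α.re, const S₀ α.im, 0, 0⟩
  map_one' := by ext <;> simp [QuadraticAlgebra.re_one, QuadraticAlgebra.im_one]
  map_zero' := by ext <;> simp
  map_add' x y := by ext <;> simp
  map_mul' x y := by ext <;> simp

/-- The quaternion generator `F`, with `F² = t`. -/
def elF (c : F) (S₀ : Finset Fˣ) : Ord c S₀ := ⟨0, 0, 1, 0⟩

lemma isUnit_elF (c : F) (S₀ : Finset Fˣ) : IsUnit (elF c S₀) := by
  apply isUnit_of_nrd
  simpa [elF] using isUnit_tt S₀

/-- The elements `α ∈ F[Z]` with `N(α) = τ⁻¹`. -/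
abbrev NormFiber (c : F) (τ : Fˣ) : Type _ :=
  {α : FZ c // QuadraticAlgebra.norm α = ((τ⁻¹ : Fˣ) : F)}

lemma isUnit_one_add (c : F) (S₀ : Finset Fˣ) (τ : S₀) (α : NormFiber c (τ : Fˣ)) :
    IsUnit (1 + emb c S₀ α.1 * elF c S₀) := by
  apply isUnit_of_nrd
  have h : α.1.re ^ 2 - c * α.1.im ^ 2 = (((τ : Fˣ)⁻¹ : Fˣ) : F) := by
    have h2 := α.2
    rw [QuadraticAlgebra.norm_def] at h2
    linear_combination h2
  have h' := congrArg (const S₀) h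
  have h1 : const S₀ (((τ : Fˣ)⁻¹ : Fˣ) : F) * const S₀ ((τ : Fˣ) : F) = 1 := by
    rw [← map_mul, Units.inv_mul, map_one]
  have key := ((isUnit_const S₀ (τ : Fˣ)⁻¹).mul (isUnit_tt_sub S₀ τ)).neg
  convert key using 1
  simp only [map_sub, map_mul, map_pow] at h'
  simp [emb, elF, -Units.val_inv_eq_inv_val]
  linear_combination (-tt S₀) * h' - h1

/-- The class `[1 + αF] ∈ Λ_S`, for `τ ∈ S₀` and `N(α) = τ⁻¹`. -/
def oneAdd (c : F) (S₀ : Finset Fˣ) (τ : S₀) (α : NormFiber c (τ : Fˣ)) : Lam c S₀ :=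
  cls c S₀ (isUnit_one_add c S₀ τ α).unit

/-- The subset `PA_τ = {[1 + αF] : N(α) = τ⁻¹}` of `Λ_S`. -/
def PA (c : F) (S₀ : Finset Fˣ) (τ : S₀) : Set (Lam c S₀) := Set.range (oneAdd c S₀ τ)

/-- The subgroup `Γ_S` of `Λ_S` generated by all `PA_τ`, `τ ∈ S₀`. -/
def Gam (c : F) (S₀ : Finset Fˣ) : Subgroup (Lam c S₀) := Subgroup.closure (⋃ τ : S₀, PA c S₀ τ)

/-- The subgroup `Λ_B` of `Λ_S`, for `B = {0, ∞}`. -/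
def LamB (c : F) (S₀ : Finset Fˣ) : Subgroup (Lam c S₀) :=
  (inclLam c (Finset.empty_subset S₀)).range

/-- The element `s = [F]` of `Λ_S`. -/
def elS (c : F) (S₀ : Finset Fˣ) : Lam c S₀ := cls c S₀ (isUnit_elF c S₀).unit

/-- The element `d = [δ]` of `Λ_S`. -/
def elD (c : F) (S₀ : Finset Fˣ) (δ : (FZ c)ˣ) : Lam c S₀ :=
  cls c S₀ (Units.map (emb c S₀).toMonoidHom δ)

/-- `α₀` is an admissible choice for the definition of `a_τ = [1 + α₀F]`: if `τ` is a square in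
`F`, then `α₀ ∈ F` is a square root of `τ⁻¹`; if not, then `α₀ = α₁ δ⁻¹` for a square root
`α₁ ∈ F` of `N(δ) τ⁻¹` (over a field with `q` elements, `N(δ) = δ^(q+1)`). -/
def IsBase (c : F) (δ : (FZ c)ˣ) (τ : Fˣ) (α₀ : FZ c) : Prop :=
  (IsSquare (τ : F) ∧ ∃ a : F, a ^ 2 = ((τ⁻¹ : Fˣ) : F) ∧ α₀ = algebraMap F (FZ c) a) ∨
  (¬ IsSquare (τ : F) ∧ ∃ α₁ : F,
    α₁ ^ 2 = QuadraticAlgebra.norm (δ : FZ c) * ((τ⁻¹ : Fˣ) : F) ∧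
      α₀ = algebraMap F (FZ c) α₁ * ((δ⁻¹ : (FZ c)ˣ) : FZ c))

lemma IsBase.norm_eq {c : F} {δ : (FZ c)ˣ} {τ : Fˣ} {α₀ : FZ c} (h : IsBase c δ τ α₀) :
    QuadraticAlgebra.norm α₀ = ((τ⁻¹ : Fˣ) : F) := by
  rcases h with ⟨-, a, ha, rfl⟩ | ⟨-, a, ha, rfl⟩
  · rw [QuadraticAlgebra.norm_algebraMap, ha]
  · rw [map_mul, QuadraticAlgebra.norm_algebraMap, ha, mul_right_comm, ← map_mul, Units.mul_inv,
      map_one, one_mul]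

/-- The element `a_τ = [1 + α₀F]` of `Λ_S`. -/
def elA (c : F) (S₀ : Finset Fˣ) (δ : (FZ c)ˣ) (τ : S₀) (α₀ : FZ c) (h : IsBase c δ τ α₀) :
    Lam c S₀ :=
  oneAdd c S₀ τ ⟨α₀, h.norm_eq⟩

end Order

/-! ### The functions `ζ` -/

section Zeta

variable {F : Type*} [Field F] {c : F}

instance fact_ne [hc : Fact (¬ IsSquare c)] : Fact (∀ r : F, r ^ 2 ≠ c + 0 * r) :=
  ⟨fun r hr => hc.out ⟨r, by rw [← sq, hr]; ring⟩⟩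

/-- `ζ_α(β) = (1 + α/β) / (1 + ᾱ/β̄)`, computed in the field `F[Z]`. -/
def zeta [Fact (¬ IsSquare c)] (α β : FZ c) : FZ c := (1 + α / β) / (1 + star α / star β)

lemma norm_zeta_mul [Fact (¬ IsSquare c)] {τ σ : Fˣ} (h : τ ≠ σ) (α : NormFiber c τ)
    (β : NormFiber c σ) :
    QuadraticAlgebra.norm (zeta α.1 β.1 * β.1) = ((σ⁻¹ : Fˣ) : F) := by
  have hβ : β.1 ≠ 0 := by
    intro h0
    have := β.2
    rw [h0, QuadraticAlgebra.norm_zero] at this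
    exact (σ⁻¹).ne_zero this.symm
  have hx : 1 + α.1 / β.1 ≠ 0 := by
    intro h0
    have h1 : α.1 = -β.1 := by
      have h3 : α.1 / β.1 = -1 := eq_neg_of_add_eq_zero_right h0
      rw [div_eq_iff hβ] at h3
      rw [h3, neg_one_mul]
    have h2 := α.2
    rw [h1, QuadraticAlgebra.norm_neg, β.2] at h2
    exact h (inv_injective (Units.ext h2)).symm
  have hs : 1 + star α.1 / star β.1 = star (1 + α.1 / β.1) := by
    have hm : star (α.1 / β.1) * star β.1 = star α.1 := by
      rw [← star_mul', div_mul_cancel₀ _ hβ]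
    have hβ' : star β.1 ≠ 0 := star_ne_zero.mpr hβ
    rw [star_add, star_one, ← hm, mul_div_cancel_right₀ _ hβ']
  have hx' : star (1 + α.1 / β.1) ≠ 0 := star_ne_zero.mpr hx
  have hz : zeta α.1 β.1 * star (1 + α.1 / β.1) = 1 + α.1 / β.1 := by
    rw [zeta, hs, div_mul_cancel₀ _ hx']
  have hn := congrArg QuadraticAlgebra.norm hz
  rw [map_mul, QuadraticAlgebra.norm_star] at hn
  have hn0 : QuadraticAlgebra.norm (1 + α.1 / β.1) ≠ 0 := by
    rwa [Ne, QuadraticAlgebra.norm_eq_zero_iff_eq_zero]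
  rw [map_mul, mul_eq_right₀ hn0 |>.mp hn, one_mul, β.2]

/-- The element `ζ_α(β) β`, which has the same norm as `β`. -/
def zetaMul [Fact (¬ IsSquare c)] {τ σ : Fˣ} (h : τ ≠ σ) (α : NormFiber c τ)
    (β : NormFiber c σ) : NormFiber c σ :=
  ⟨zeta α.1 β.1 * β.1, norm_zeta_mul h α β⟩

end Zeta

/-! ### The presentation -/

section Presentation

/-- `G` is presented by the generators `gen x`, `x : X`, subject to the relators `rels`. -/
def IsPresentation {X G : Type*} [Group G] (gen : X → G) (rels : Set (FreeGroup X)) : Prop :=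
  Subgroup.closure (Set.range gen) = ⊤ ∧
    (FreeGroup.lift gen).ker = Subgroup.normalClosure rels

/-- Names of the generators `d`, `s` and `a_τ` for `τ ∈ S₀`. -/
inductive Gen {F : Type*} [Field F] (S₀ : Finset Fˣ) : Type _
  | d : Gen S₀
  | s : Gen S₀
  | a (τ : S₀) : Gen S₀

variable {F : Type*} [Field F]

/-- The values in `Λ_S` of the generators. -/
def genVal (c : F) (S₀ : Finset Fˣ) (δ : (FZ c)ˣ) (α₀ : S₀ → FZ c)
    (hα₀ : ∀ τ : S₀, IsBase c δ τ (α₀ τ)) : Gen S₀ → Lam c S₀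
  | .d => elD c S₀ δ
  | .s => elS c S₀
  | .a τ => elA c S₀ δ τ (α₀ τ) (hα₀ τ)

section Words

variable (S₀ : Finset Fˣ)

/-- The letter `d`. -/
def wd : FreeGroup (Gen S₀) := FreeGroup.of .d

/-- The letter `s`. -/
def ws : FreeGroup (Gen S₀) := FreeGroup.of .s

/-- The letter `a_τ`. -/
def wa (τ : S₀) : FreeGroup (Gen S₀) := FreeGroup.of (.a τ)

/-- The word `dⁱ a_τ d⁻ⁱ`. -/
def word (τ : S₀) (i : ℕ) : FreeGroup (Gen S₀) := wd S₀ ^ i * wa S₀ τ * (wd S₀ ^ i)⁻¹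

/-- Relations I: `d^(q+1) = s² = (sd)² = 1`, and `(d^((q+1)/2) a_τ)² = 1` for all `τ ∈ S₀`, where
`q` is the number of elements of `F`. -/
def relsI : Set (FreeGroup (Gen S₀)) :=
  {wd S₀ ^ (Nat.card F + 1), ws S₀ ^ 2, (ws S₀ * wd S₀) ^ 2} ∪
    {w | ∃ τ : S₀, w = (wd S₀ ^ ((Nat.card F + 1) / 2) * wa S₀ τ) ^ 2}

/-- Relations II: `a_τ = s a_τ s` if `τ` is a square in `F`, and `a_τ = (sd) a_τ (sd)⁻¹`
otherwise. -/
def relsII : Set (FreeGroup (Gen S₀)) :=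
  {w | ∃ τ : S₀, IsSquare ((τ : Fˣ) : F) ∧
      w = wa S₀ τ * (ws S₀ * wa S₀ τ * ws S₀)⁻¹} ∪
    {w | ∃ τ : S₀, ¬ IsSquare ((τ : Fˣ) : F) ∧
      w = wa S₀ τ * (ws S₀ * wd S₀ * wa S₀ τ * (ws S₀ * wd S₀)⁻¹)⁻¹}

end Words

/-- The word `dⁱ a_τ d⁻ⁱ`, with `0 ≤ i ≤ q`, spells the element `[1 + αF]` of `PA_τ`. -/
def Spells (c : F) (S₀ : Finset Fˣ) (δ : (FZ c)ˣ) (α₀ : S₀ → FZ c)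
    (hα₀ : ∀ τ : S₀, IsBase c δ τ (α₀ τ)) (τ : S₀) (i : ℕ) (α : NormFiber c (τ : Fˣ)) : Prop :=
  i ≤ Nat.card F ∧ FreeGroup.lift (genVal c S₀ δ α₀ hα₀) (word S₀ τ i) = oneAdd c S₀ τ α

/-- Relations III: for `τ ≠ σ` in `S₀`, `[1 + αF] ∈ PA_τ` and `[1 + βF] ∈ PA_σ`,
`[1 + αF] [1 + βF] = [1 + ζ_α(β) β F] [1 + ζ_β(α) α F]`,
where each of the four factors is spelled as a word `dⁱ a_ρ d⁻ⁱ` with `0 ≤ i ≤ q`. -/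
def relsIII (c : F) [Fact (¬ IsSquare c)] (S₀ : Finset Fˣ) (δ : (FZ c)ˣ) (α₀ : S₀ → FZ c)
    (hα₀ : ∀ τ : S₀, IsBase c δ τ (α₀ τ)) : Set (FreeGroup (Gen S₀)) :=
  {w | ∃ (τ σ : S₀) (h : (τ : Fˣ) ≠ (σ : Fˣ)) (α : NormFiber c (τ : Fˣ))
      (β : NormFiber c (σ : Fˣ)) (i j k l : ℕ),
      Spells c S₀ δ α₀ hα₀ τ i α ∧ Spells c S₀ δ α₀ hα₀ σ j β ∧
      Spells c S₀ δ α₀ hα₀ σ k (zetaMul h α β) ∧ Spells c S₀ δ α₀ hα₀ τ l (zetaMul h.symm β α) ∧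
      w = word S₀ τ i * word S₀ σ j * (word S₀ σ k * word S₀ τ l)⁻¹}

end Presentation

end QuatLattice

end

/-! Write a quaternion as `x + yF` with `x, y` over `F[Z]`, so that its reduced norm is `N(x) -
tN(y)`. Since `c` is a non-square, `N` is anisotropic: over `F[t]` the terms `N(x)` and `tN(y)` have
even and odd degree and cannot cancel.

Existence of factorizations. A unit of the order can be scaled to a polynomial quaternion `w` whose
norm is an `S`-unit, so every irreducible factor of `nrd w` belongs to a place of `S`. A root at `0`
lets `F` be split off on the right. At a root `τ` the reduction of `w` is not invertible, and some
`1 + αF` with `N(α) = τ⁻¹` splits off on the left. Each step lowers the degree of the norm by one,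
and constant norm forces `w` to be constant. Hence `Λ_S = Γ_S · Λ_B`
(`exists_eq_mul_constHom_mul_elS_pow`).

Uniqueness. The product `(1 + αF)(1 + βF)` depends only on `α + β` and `αβ̄`, which gives the square
relations (`linear_mul_linear_eq`). They allow all letters of one place `τ` in a word to be moved to
its right end. If those letters form a reduced word, its value at `t = τ` is nonzero but not
invertible, while everything else is invertible there; a scalar cannot behave like this. Otherwise
two letters cancel and the word gets shorter. Only the inverse and square relations enter, so
`eq_one_of_map_mul_cls_eq_one` is stated for any group `Q` over `Λ_S` in which they hold.

With `Q = Λ_S` it yields `Γ_S ∩ Λ_B = 1`. With `Q` the abstractly presented group it yields the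
presentation (`injective_of_relations`). There relations I and II present the dihedral group `Λ_B`
and control its action. By Hilbert 90 (`exists_rot_eq`) the maps `α ↦ eα/ē` are transitive on each
norm fiber, so `PA_τ` is one orbit under conjugation by `d`. The half turn `d^((q+1)/2)` acts as `α
↦ -α`, so I also contains the inverse relations. -/

noncomputable section

namespace QuatLattice

/-! ### Quaternion algebras over commutative rings -/

section Quaternion

variable {R S : Type*} [CommRing R] [CommRing S] {a b : R} {a' b' : S}

/-- The coefficientwise map of quaternion algebras induced by a ring homomorphism. -/
def qmap (f : R →+* S) (ha : f a = a') (hb : f b = b') : ℍ[R, a, b] →+* ℍ[S, a', b'] where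
  toFun w := ⟨f w.re, f w.imI, f w.imJ, f w.imK⟩
  map_one' := by ext <;> simp
  map_zero' := by ext <;> simp
  map_add' x y := by ext <;> simp
  map_mul' x y := by ext <;> simp [ha, hb]

lemma qmap_injective {f : R →+* S} (hf : Function.Injective f) (ha : f a = a') (hb : f b = b') :
    Function.Injective (qmap f ha hb) := by
  intro x y h
  have h1 := congrArg QuaternionAlgebra.re h
  have h2 := congrArg QuaternionAlgebra.imI h
  have h3 := congrArg QuaternionAlgebra.imJ h
  have h4 := congrArg QuaternionAlgebra.imK h
  exact QuaternionAlgebra.ext (hf h1) (hf h2) (hf h3) (hf h4)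

lemma qmap_algebraMap (f : R →+* S) (ha : f a = a') (hb : f b = b') (r : R) :
    qmap f ha hb (algebraMap R _ r) = algebraMap S _ (f r) := by
  ext <;> simp [qmap, QuaternionAlgebra.algebraMap_eq]

/-- The reduced norm of a quaternion algebra. -/
def nrd : ℍ[R, a, b] →* R where
  toFun w := w.re ^ 2 - a * w.imI ^ 2 - b * w.imJ ^ 2 + a * b * w.imK ^ 2
  map_one' := by simp
  map_mul' x y := by simp; ring

lemma nrd_apply (w : ℍ[R, a, b]) :
    nrd w = w.re ^ 2 - a * w.imI ^ 2 - b * w.imJ ^ 2 + a * b * w.imK ^ 2 := rfl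

lemma nrd_qmap (f : R →+* S) (ha : f a = a') (hb : f b = b') (w : ℍ[R, a, b]) :
    nrd (qmap f ha hb w) = f (nrd w) := by
  simp [nrd_apply, qmap, ha, hb]

lemma nrd_algebraMap (r : R) : nrd (algebraMap R ℍ[R, a, b] r) = r ^ 2 := by
  simp [nrd_apply, QuaternionAlgebra.algebraMap_eq]

lemma isUnit_of_isUnit_nrd {w : ℍ[R, a, b]} (h : IsUnit (nrd w)) : IsUnit w :=
  isUnit_of_nrd w h

end Quaternion

/-! ### The ring of `S`-integers -/

section SIntegers

variable {F : Type*} [Field F] {S₀ : Finset Fˣ}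

lemma algebraMap_sInt_injective : Function.Injective (algebraMap F[X] (SInt S₀)) := by
  intro p q h
  exact RatFunc.algebraMap_injective F (congrArg Subtype.val h)

/-- The maximal ideal of `F[t]` generated by an irreducible polynomial. -/
def primeOf {p : F[X]} (hp : Irreducible p) : IsDedekindDomain.HeightOneSpectrum F[X] where
  asIdeal := Ideal.span {p}
  isPrime := (PrincipalIdealRing.isMaximal_of_irreducible hp).isPrime
  ne_bot := by simpa [Ideal.span_singleton_eq_bot] using hp.ne_zero

/-- Compare valuations at `p`: if this place were outside `S`, the left side would have valuation
below `1` because `r` is regular there, whereas `q` has valuation exactly `1`. -/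
lemma primeOf_mem_places_of_mul_eq {p q : F[X]} (hp : Irreducible p) (hq : ¬ p ∣ q) (r : SInt S₀)
    (h : algebraMap F[X] (SInt S₀) p * r = algebraMap F[X] (SInt S₀) q) :
    primeOf hp ∈ places S₀ := by
  by_contra hv
  have hr := r.2 _ hv
  have h' : algebraMap F[X] (RatFunc F) p * r.1 = algebraMap F[X] (RatFunc F) q :=
    congrArg Subtype.val h
  have h1 := congrArg ((primeOf hp).valuation (RatFunc F)) h'
  rw [map_mul] at h1
  have hlt : (primeOf hp).valuation (RatFunc F) (algebraMap F[X] (RatFunc F) p) < 1 :=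
    ((primeOf hp).valuation_lt_one_iff_mem p).2 (Ideal.mem_span_singleton_self p)
  have hq1 : (primeOf hp).valuation (RatFunc F) (algebraMap F[X] (RatFunc F) q) = 1 := by
    rw [IsDedekindDomain.HeightOneSpectrum.valuation_eq_one_iff_notMem]
    intro hm
    exact hq (Ideal.mem_span_singleton.1 hm)
  rw [hq1] at h1
  exact absurd h1 (mul_lt_one_of_lt_of_le hlt hr).ne

lemma isRoot_of_primeOf_mem_places {p : F[X]} (hp : Irreducible p)
    (h : primeOf hp ∈ places S₀) : p.IsRoot 0 ∨ ∃ τ ∈ S₀, p.IsRoot (τ : F) := by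
  rcases h with h | ⟨τ, hτ, h⟩
  · left
    have h' : Ideal.span {p} = Ideal.span {X} := h
    rw [← dvd_iff_isRoot, C_0, sub_zero]
    exact Ideal.mem_span_singleton.1 (h' ▸ Ideal.mem_span_singleton_self p)
  · right
    refine ⟨τ, hτ, dvd_iff_isRoot.1 (Ideal.mem_span_singleton.1 ?_)⟩
    exact h ▸ Ideal.mem_span_singleton_self p

lemma isUnit_of_primeOf_mem_places {p : F[X]} (hp : Irreducible p)
    (h : primeOf hp ∈ places S₀) : IsUnit (algebraMap F[X] (SInt S₀) p) := by
  refine isUnit_algebraMap_of_irreducible S₀ hp fun v hv => ?_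
  have : v = primeOf hp := IsDedekindDomain.HeightOneSpectrum.ext hv
  rwa [this]

/-- An irreducible factor of `p` is again invertible among the `S`-integers, so its place lies in
`S`. All finite places of `S` are rational, which turns the factor into a root. -/
lemma exists_root_of_isUnit {p : F[X]} (hp : IsUnit (algebraMap F[X] (SInt S₀) p))
    (hdeg : p.natDegree ≠ 0) : p.IsRoot 0 ∨ ∃ τ ∈ S₀, p.IsRoot (τ : F) := by
  obtain ⟨g, hg, q, rfl⟩ := WfDvdMonoid.exists_irreducible_factor
    (not_isUnit_of_natDegree_pos p (Nat.pos_of_ne_zero hdeg))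
    (by rintro rfl; simp at hdeg)
  obtain ⟨u, hu⟩ := hp
  have h := primeOf_mem_places_of_mul_eq (S₀ := S₀) (q := 1) hg
    (fun h => hg.not_isUnit (isUnit_of_dvd_one h)) (algebraMap F[X] (SInt S₀) q * (u⁻¹ : (SInt S₀)ˣ))
    (by rw [← mul_assoc, ← map_mul, ← hu, Units.mul_inv, map_one])
  rcases isRoot_of_primeOf_mem_places hg h with h | ⟨τ, hτ, h⟩
  · exact Or.inl (h.dvd (dvd_mul_right _ _))
  · exact Or.inr ⟨τ, hτ, h.dvd (dvd_mul_right _ _)⟩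

lemma isUnit_of_mul_eq_of_isCoprime {p q : F[X]} (hp0 : p ≠ 0) (hpq : IsCoprime p q) (r : SInt S₀)
    (h : algebraMap F[X] (SInt S₀) p * r = algebraMap F[X] (SInt S₀) q) :
    IsUnit (algebraMap F[X] (SInt S₀) p) := by
  induction p using WfDvdMonoid.induction_on_irreducible generalizing r with
  | zero => exact absurd rfl hp0
  | unit u hu => exact hu.map _
  | mul p g hp hg ih =>
    rw [map_mul, mul_assoc] at h
    have hg' := isUnit_of_primeOf_mem_places hg (primeOf_mem_places_of_mul_eq (S₀ := S₀) hg
      (fun hd => hg.not_isUnit (hpq.of_mul_left_left.isUnit_of_dvd' dvd_rfl hd)) _ h)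
    rw [map_mul]
    refine hg'.mul (ih hp hpq.of_mul_left_right (algebraMap F[X] (SInt S₀) g * r) ?_)
    rw [← h]; ring

/-- Denominators can be cleared by `S`-units: in lowest terms, every irreducible factor of the
denominator of an `S`-integer lies in `S`. -/
lemma exists_isUnit_mul_eq_algebraMap (r : SInt S₀) :
    ∃ p q : F[X], IsUnit (algebraMap F[X] (SInt S₀) p) ∧
      algebraMap F[X] (SInt S₀) p * r = algebraMap F[X] (SInt S₀) q := by
  have h : algebraMap F[X] (SInt S₀) (RatFunc.denom r.1) * r =
      algebraMap F[X] (SInt S₀) (RatFunc.num r.1) := by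
    apply Subtype.ext
    have h0 : algebraMap F[X] (RatFunc F) (RatFunc.denom r.1) ≠ 0 := by
      simpa using RatFunc.denom_ne_zero r.1
    have := RatFunc.num_div_denom r.1
    rw [div_eq_iff h0] at this
    change algebraMap F[X] (RatFunc F) (RatFunc.denom r.1) * r.1 =
      algebraMap F[X] (RatFunc F) (RatFunc.num r.1)
    rw [this, mul_comm]
  exact ⟨_, _, isUnit_of_mul_eq_of_isCoprime (RatFunc.denom_ne_zero r.1)
    (RatFunc.isCoprime_num_denom r.1).symm r h, h⟩

end SIntegers

/-! ### The polynomial quaternion order -/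

section PolynomialOrder

variable {F : Type*} [Field F] {c : F}

/-- The order `F[t]{Z, F} / (Z² = c, F² = t, ZF + FZ = 0)`. -/
abbrev PolOrd (c : F) : Type _ := ℍ[F[X], C c, X]

variable (c) in
/-- The inclusion of the polynomial order into the `S`-integral order. -/
def toOrd (S₀ : Finset Fˣ) : PolOrd c →+* Ord c S₀ :=
  qmap (algebraMap F[X] (SInt S₀)) rfl rfl

variable (c) in
/-- Reduction of the polynomial order at the place `t = τ`. -/
def evalAt (τ : F) : PolOrd c →+* ℍ[F, c, τ] :=
  qmap (evalRingHom τ) (by simp) (by simp)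

/-- The polynomial quaternion `1 + αF`. -/
def linear (α : FZ c) : PolOrd c := ⟨1, 0, C α.re, C α.im⟩

/-- The constant quaternions. -/
def polConst : FZ c →+* PolOrd c where
  toFun α := ⟨C α.re, C α.im, 0, 0⟩
  map_one' := by ext1 <;> simp [QuadraticAlgebra.re_one, QuadraticAlgebra.im_one]
  map_zero' := by ext1 <;> simp
  map_add' x y := by ext1 <;> simp
  map_mul' x y := by ext1 <;> simp

variable (c) in
/-- The generator `F` as a polynomial quaternion. -/
def polF : PolOrd c := ⟨0, 0, 1, 0⟩

/-- The element `x + yF` of the quaternion algebra `(c, τ)` over `F`, for `x, y ∈ F[Z]`. -/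
def ofPair (τ : F) (x y : FZ c) : ℍ[F, c, τ] := ⟨x.re, x.im, y.re, y.im⟩

lemma exists_ofPair (τ : F) (w : ℍ[F, c, τ]) : ∃ x y : FZ c, w = ofPair τ x y :=
  ⟨⟨w.re, w.imI⟩, ⟨w.imJ, w.imK⟩, rfl⟩

lemma ofPair_mul (τ : F) (x y u v : FZ c) :
    ofPair τ x y * ofPair τ u v =
      ofPair τ (x * u + algebraMap F (FZ c) τ * y * star v) (x * v + y * star u) := by
  ext <;> simp [ofPair] <;> ring

lemma ofPair_eq_zero {τ : F} {x y : FZ c} : ofPair τ x y = 0 ↔ x = 0 ∧ y = 0 := by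
  simp [ofPair, QuaternionAlgebra.ext_iff, QuadraticAlgebra.ext_iff, and_assoc]

lemma nrd_ofPair (τ : F) (x y : FZ c) :
    nrd (ofPair τ x y) = QuadraticAlgebra.norm x - τ * QuadraticAlgebra.norm y := by
  simp [nrd_apply, ofPair, QuadraticAlgebra.norm_def]; ring

lemma evalAt_linear (τ : F) (α : FZ c) : evalAt c τ (linear α) = ofPair τ 1 α := by
  ext <;> simp [evalAt, linear, qmap, ofPair, QuadraticAlgebra.re_one, QuadraticAlgebra.im_one]

lemma linear_eq (α : FZ c) : linear α = 1 + polConst α * polF c := by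
  ext1 <;> simp [linear, polConst, polF]

lemma nrd_evalAt (τ : F) (w : PolOrd c) : nrd (evalAt c τ w) = (nrd w).eval τ :=
  nrd_qmap _ _ _ w

lemma nrd_linear (α : FZ c) : nrd (linear α) = 1 - C (QuadraticAlgebra.norm α) * X := by
  simp [nrd_apply, linear, QuadraticAlgebra.norm_def]; ring

lemma nrd_polConst (α : FZ c) : nrd (polConst α) = C (QuadraticAlgebra.norm α) := by
  simp [nrd_apply, polConst, QuadraticAlgebra.norm_def]; ring

lemma nrd_polF : nrd (polF c) = -X := by
  simp [nrd_apply, polF]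

lemma toOrd_injective (S₀ : Finset Fˣ) : Function.Injective (toOrd c S₀) :=
  qmap_injective algebraMap_sInt_injective rfl rfl

lemma nrd_toOrd (S₀ : Finset Fˣ) (w : PolOrd c) :
    nrd (toOrd c S₀ w) = algebraMap F[X] (SInt S₀) (nrd w) :=
  nrd_qmap _ _ _ w

lemma toOrd_polConst (S₀ : Finset Fˣ) (α : FZ c) :
    toOrd c S₀ (polConst α) = emb c S₀ α :=
  QuaternionAlgebra.ext rfl rfl (map_zero _) (map_zero _)

lemma toOrd_polF (S₀ : Finset Fˣ) : toOrd c S₀ (polF c) = elF c S₀ := by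
  ext <;> simp [toOrd, polF, qmap, elF]

lemma toOrd_linear (S₀ : Finset Fˣ) (α : FZ c) :
    toOrd c S₀ (linear α) = 1 + emb c S₀ α * elF c S₀ := by
  rw [linear_eq, map_add, map_one, map_mul, toOrd_polConst, toOrd_polF]

lemma toOrd_algebraMap (S₀ : Finset Fˣ) (p : F[X]) :
    toOrd c S₀ (algebraMap F[X] (PolOrd c) p) =
      algebraMap (SInt S₀) (Ord c S₀) (algebraMap F[X] (SInt S₀) p) :=
  qmap_algebraMap _ _ _ p

/-- A polynomial quaternion vanishing at `t = τ` is divisible by `t - τ`. -/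
lemma exists_eq_mul_of_evalAt_eq_zero {τ : F} {w : PolOrd c} (h : evalAt c τ w = 0) :
    ∃ v : PolOrd c, w = algebraMap F[X] (PolOrd c) (X - C τ) * v := by
  have aux : ∀ p : F[X], p.eval τ = 0 → p = (X - C τ) * (p /ₘ (X - C τ)) := fun p hp =>
    (mul_divByMonic_eq_iff_isRoot.2 hp).symm
  refine ⟨⟨w.re /ₘ (X - C τ), w.imI /ₘ (X - C τ), w.imJ /ₘ (X - C τ), w.imK /ₘ (X - C τ)⟩, ?_⟩
  rw [← Algebra.smul_def]
  ext1
  · exact aux _ (congrArg QuaternionAlgebra.re h)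
  · exact aux _ (congrArg QuaternionAlgebra.imI h)
  · exact aux _ (congrArg QuaternionAlgebra.imJ h)
  · exact aux _ (congrArg QuaternionAlgebra.imK h)

end PolynomialOrder

/-! ### Classes in `Λ_S` -/

section Classes

variable {F : Type*} [Field F] {c : F} {S₀ : Finset Fˣ}

lemma cls_eq_iff {u v : (Ord c S₀)ˣ} :
    cls c S₀ u = cls c S₀ v ↔ ∃ r : (SInt S₀)ˣ,
      algebraMap (SInt S₀) (Ord c S₀) r * (u : Ord c S₀) = v := by
  rw [cls, QuotientGroup.mk'_eq_mk']
  constructor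
  · rintro ⟨_, ⟨r, rfl⟩, h⟩
    exact ⟨r, by rw [← h, Algebra.commutes]; rfl⟩
  · rintro ⟨r, h⟩
    refine ⟨_, ⟨r, rfl⟩, Units.ext ?_⟩
    rw [← h, Algebra.commutes]; rfl

lemma cls_eq_one_iff {u : (Ord c S₀)ˣ} :
    cls c S₀ u = 1 ↔ ∃ r : (SInt S₀)ˣ, (u : Ord c S₀) = algebraMap (SInt S₀) (Ord c S₀) r := by
  rw [← map_one (cls c S₀), eq_comm, cls_eq_iff]
  simp [eq_comm]

lemma cls_surjective (g : Lam c S₀) : ∃ u, cls c S₀ u = g := QuotientGroup.mk'_surjective _ g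

lemma cls_eq_cls_of_val_eq {u v : (Ord c S₀)ˣ} (h : (u : Ord c S₀) = v) :
    cls c S₀ u = cls c S₀ v := congrArg _ (Units.ext h)

/-- The unit `1 + αF` of the order. -/
def linUnit (S₀ : Finset Fˣ) (τ : S₀) (α : NormFiber c (τ : Fˣ)) : (Ord c S₀)ˣ :=
  (isUnit_one_add c S₀ τ α).unit

lemma linUnit_val (τ : S₀) (α : NormFiber c (τ : Fˣ)) :
    (linUnit S₀ τ α : Ord c S₀) = toOrd c S₀ (linear α.1) :=
  (toOrd_linear S₀ α.1).symm

lemma oneAdd_eq_cls (τ : S₀) (α : NormFiber c (τ : Fˣ)) :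
    oneAdd c S₀ τ α = cls c S₀ (linUnit S₀ τ α) := rfl

/-- Both representatives have constant coefficient `1`, so the scalar relating them is `1`. -/
lemma oneAdd_injective (τ : S₀) : Function.Injective (oneAdd c S₀ τ) := by
  intro α β h
  rw [oneAdd_eq_cls, oneAdd_eq_cls, cls_eq_iff] at h
  obtain ⟨r, h⟩ := h
  rw [linUnit_val, linUnit_val, ← Algebra.smul_def] at h
  have h1 : (r : SInt S₀) = 1 := by
    simpa [toOrd, qmap, linear] using congrArg QuaternionAlgebra.re h
  rw [h1, one_smul] at h
  have h2 := toOrd_injective S₀ h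
  refine Subtype.ext (QuadraticAlgebra.ext ?_ ?_)
  · exact C_injective (congrArg QuaternionAlgebra.imJ h2)
  · exact C_injective (congrArg QuaternionAlgebra.imK h2)

/-- The element `-α` of the norm fiber. -/
def NormFiber.neg {τ : Fˣ} (α : NormFiber c τ) : NormFiber c τ :=
  ⟨-α.1, by rw [QuadraticAlgebra.norm_neg]; exact α.2⟩

lemma linear_mul_linear (α β : FZ c) : linear α * linear β =
    ⟨1 + X * C (α * star β).re, X * C (α * star β).im, C (α + β).re, C (α + β).im⟩ := by
  ext1 <;> simp [linear] <;> ring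

lemma linear_mul_linear_neg (α : FZ c) : linear α * linear (-α) =
    algebraMap F[X] (PolOrd c) (1 - C (QuadraticAlgebra.norm α) * X) := by
  rw [linear_mul_linear]
  ext1 <;> simp [QuaternionAlgebra.algebraMap_eq, QuadraticAlgebra.norm_def] <;> ring

lemma isUnit_algebraMap_nrd_linear (τ : S₀) (α : NormFiber c (τ : Fˣ)) :
    IsUnit (algebraMap F[X] (SInt S₀) (1 - C (QuadraticAlgebra.norm α.1) * X)) := by
  rw [← nrd_linear, ← nrd_toOrd, ← linUnit_val]
  exact (linUnit S₀ τ α).isUnit.map nrd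

lemma oneAdd_mul_oneAdd_neg (τ : S₀) (α : NormFiber c (τ : Fˣ)) :
    oneAdd c S₀ τ α * oneAdd c S₀ τ α.neg = 1 := by
  rw [oneAdd_eq_cls, oneAdd_eq_cls, ← map_mul, cls_eq_one_iff]
  refine ⟨(isUnit_algebraMap_nrd_linear τ α).unit, ?_⟩
  rw [Units.val_mul, linUnit_val, linUnit_val, ← map_mul, NormFiber.neg, linear_mul_linear_neg,
    toOrd_algebraMap]
  rfl

lemma ne_zero_of_norm {τ : Fˣ} (α : NormFiber c τ) : α.1 ≠ 0 := by
  intro h0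
  have := α.2
  rw [h0, QuadraticAlgebra.norm_zero] at this
  exact (τ⁻¹).ne_zero this.symm

lemma add_ne_zero_of_norm {τ σ : Fˣ} (h : τ ≠ σ) (α : NormFiber c τ) (β : NormFiber c σ) :
    α.1 + β.1 ≠ 0 := by
  intro h0
  have h2 := α.2
  rw [eq_neg_of_add_eq_zero_left h0, QuadraticAlgebra.norm_neg, β.2] at h2
  exact h (inv_injective (Units.ext h2)).symm

/-! ### Square relations between letters at two different places -/

section Square

variable [Fact (¬ IsSquare c)]

/-- This form shows the symmetry: the factor `(α + β) / star (α + β)` has norm `1` and is unchanged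
when `α` and `β` are exchanged. -/
lemma zeta_mul_eq {α β : FZ c} (hβ : β ≠ 0) (h : α + β ≠ 0) :
    zeta α β * β = (α + β) / star (α + β) * star β := by
  have h1 : star β ≠ 0 := star_ne_zero.mpr hβ
  have h2 : star α + star β ≠ 0 := by rw [← star_add]; exact star_ne_zero.mpr h
  have h3 : 1 + star α / star β ≠ 0 := by
    rw [one_add_div h1, add_comm]; exact div_ne_zero h2 h1
  rw [zeta, star_add, one_add_div h1, one_add_div hβ, add_comm (star β), add_comm β]
  field_simp

/-- With `u = (α + β) / star (α + β)` the new letters are `uβ̄` and `uᾱ`. They have the same sum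
`u(ᾱ + β̄) = α + β` and the same product `uβ̄ · ūα = αβ̄`, and by `linear_mul_linear` these two
quantities determine the quaternion product. -/
lemma linear_mul_linear_eq {τ σ : Fˣ} (h : τ ≠ σ) (α : NormFiber c τ) (β : NormFiber c σ) :
    linear α.1 * linear β.1 = linear (zetaMul h α β).1 * linear (zetaMul h.symm β α).1 := by
  have hs := add_ne_zero_of_norm h α β
  have hs' : star (α.1 + β.1) ≠ 0 := star_ne_zero.mpr hs
  have e1 : (zetaMul h α β).1 = (α.1 + β.1) / star (α.1 + β.1) * star β.1 :=
    zeta_mul_eq (ne_zero_of_norm β) hs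
  have e2 : (zetaMul h.symm β α).1 = (α.1 + β.1) / star (α.1 + β.1) * star α.1 := by
    rw [add_comm]
    exact zeta_mul_eq (ne_zero_of_norm α) (by rwa [add_comm])
  have hsum : (zetaMul h α β).1 + (zetaMul h.symm β α).1 = α.1 + β.1 := by
    rw [e1, e2, ← mul_add, add_comm (star β.1), ← star_add, div_mul_cancel₀ _ hs']
  have hprod : (zetaMul h α β).1 * star (zetaMul h.symm β α).1 = α.1 * star β.1 := by
    rw [e1, e2]
    have : star ((α.1 + β.1) / star (α.1 + β.1)) * (α.1 + β.1) = star (α.1 + β.1) := by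
      conv_lhs => rw [← star_star (α.1 + β.1), star_star (star (α.1 + β.1)), ← star_mul']
      rw [star_star, div_mul_cancel₀ _ hs']
    rw [star_mul', star_star]
    have h3 : star ((α.1 + β.1) / star (α.1 + β.1)) = star (α.1 + β.1) / (α.1 + β.1) :=
      eq_div_of_mul_eq hs this
    rw [h3]
    field_simp
  rw [linear_mul_linear, linear_mul_linear, hsum, hprod]

lemma oneAdd_mul_oneAdd (τ σ : S₀) (h : (τ : Fˣ) ≠ (σ : Fˣ)) (α : NormFiber c (τ : Fˣ))
    (β : NormFiber c (σ : Fˣ)) :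
    oneAdd c S₀ τ α * oneAdd c S₀ σ β =
      oneAdd c S₀ σ (zetaMul h α β) * oneAdd c S₀ τ (zetaMul h.symm β α) := by
  simp only [oneAdd_eq_cls, ← map_mul]
  apply cls_eq_cls_of_val_eq
  simp only [Units.val_mul, linUnit_val, ← map_mul]
  rw [linear_mul_linear_eq h]

end Square

end Classes

/-! ### Generation of `Λ_S` -/

section Generation

variable {F : Type*} [Field F] {c : F}

lemma sq_sub_mul_sq_eq_zero (hc : ¬ IsSquare c) {x y : F} (h : x ^ 2 - c * y ^ 2 = 0) :
    x = 0 ∧ y = 0 := by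
  have hy : y = 0 := by
    by_contra hy
    apply hc
    refine ⟨x / y, ?_⟩
    field_simp
    linear_combination -h
  subst hy
  refine ⟨?_, rfl⟩
  simpa using h

/-- The coefficient in degree `2 * max` is the norm form evaluated at the coefficients of degree
`max`, which is nonzero by anisotropy. -/
lemma natDegree_sq_sub_mul_sq (hc : ¬ IsSquare c) (p q : F[X]) :
    (p ^ 2 - C c * q ^ 2).natDegree = 2 * max p.natDegree q.natDegree := by
  set m := max p.natDegree q.natDegree with hm
  have hp : p.natDegree ≤ m := le_max_left _ _
  have hq : q.natDegree ≤ m := le_max_right _ _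
  rcases Nat.eq_zero_or_pos m with h0 | hpos
  · rw [eq_C_of_natDegree_le_zero (hp.trans h0.le), eq_C_of_natDegree_le_zero (hq.trans h0.le), h0,
      ← C_pow, ← C_pow, ← C_mul, ← C_sub, natDegree_C]
  have hle : (p ^ 2 - C c * q ^ 2).natDegree ≤ 2 * m := by
    refine (natDegree_sub_le _ _).trans (max_le ?_ ?_)
    · exact natDegree_pow_le_of_le 2 hp
    · exact (natDegree_C_mul_le _ _).trans (natDegree_pow_le_of_le 2 hq)
  refine natDegree_eq_of_le_of_coeff_ne_zero hle fun h => ?_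
  rw [coeff_sub, coeff_C_mul, coeff_pow_of_natDegree_le hp, coeff_pow_of_natDegree_le hq] at h
  obtain ⟨h1, h2⟩ := sq_sub_mul_sq_eq_zero hc h
  have hp0 : m = p.natDegree → False := fun e => by
    rw [e, coeff_natDegree, leadingCoeff_eq_zero] at h1
    rw [h1, natDegree_zero] at e
    omega
  have hq0 : m = q.natDegree → False := fun e => by
    rw [e, coeff_natDegree, leadingCoeff_eq_zero] at h2
    rw [h2, natDegree_zero] at e
    omega
  rcases max_choice p.natDegree q.natDegree with e | e
  · exact hp0 e
  · exact hq0 e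

lemma nrd_eq_sub (w : PolOrd c) :
    nrd w = (w.re ^ 2 - C c * w.imI ^ 2) - X * (w.imJ ^ 2 - C c * w.imK ^ 2) := by
  rw [nrd_apply]; ring

/-- A polynomial quaternion whose norm is a constant is a constant. -/
lemma exists_eq_polConst (hc : ¬ IsSquare c) {w : PolOrd c} (h : (nrd w).natDegree = 0) :
    ∃ α : FZ c, w = polConst α := by
  rw [nrd_eq_sub] at h
  have h1 := natDegree_sq_sub_mul_sq hc w.re w.imI
  have h2 := natDegree_sq_sub_mul_sq hc w.imJ w.imK
  -- The part without `X` has even degree and the part with `X` has odd degree, so a constant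
  -- difference forces the odd part to vanish.
  have hJK : w.imJ ^ 2 - C c * w.imK ^ 2 = 0 := by
    by_contra hne
    have h3 : (X * (w.imJ ^ 2 - C c * w.imK ^ 2)).natDegree =
        2 * max w.imJ.natDegree w.imK.natDegree + 1 := by
      rw [natDegree_X_mul hne, h2]
    rcases lt_trichotomy (w.re ^ 2 - C c * w.imI ^ 2).natDegree
      (X * (w.imJ ^ 2 - C c * w.imK ^ 2)).natDegree with hlt | heq | hgt
    · rw [natDegree_sub_eq_right_of_natDegree_lt hlt] at h
      omega
    · omega
    · rw [natDegree_sub_eq_left_of_natDegree_lt hgt] at h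
      omega
  rw [hJK, mul_zero, sub_zero, h1] at h
  have hzero : ∀ p q : F[X], p ^ 2 - C c * q ^ 2 = 0 → q = 0 := by
    intro p q hpq
    ext n
    have hd := natDegree_sq_sub_mul_sq hc p q
    rw [hpq, natDegree_zero] at hd
    have hp := eq_C_of_natDegree_eq_zero (p := p) (by omega)
    have hq := eq_C_of_natDegree_eq_zero (p := q) (by omega)
    rw [hp, hq, ← C_pow, ← C_pow, ← C_mul, ← C_sub, C_eq_zero] at hpq
    rw [hq, (sq_sub_mul_sq_eq_zero hc hpq).2, C_0]
  have hK := hzero _ _ hJK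
  rw [hK] at hJK
  have hJ : w.imJ = 0 := by simpa using hJK
  refine ⟨⟨w.re.coeff 0, w.imI.coeff 0⟩, QuaternionAlgebra.ext ?_ ?_ hJ hK⟩
  · exact eq_C_of_natDegree_eq_zero (by omega)
  · exact eq_C_of_natDegree_eq_zero (by omega)

/-- A polynomial quaternion whose norm vanishes at `t = 0` is right divisible by `F`. -/
lemma exists_eq_mul_polF (hc : ¬ IsSquare c) {w : PolOrd c} (h : (nrd w).IsRoot 0) :
    ∃ v : PolOrd c, w = v * polF c := by
  rw [nrd_eq_sub, IsRoot.def] at h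
  simp only [eval_sub, eval_mul, eval_pow, eval_C, eval_X, zero_mul, sub_zero] at h
  obtain ⟨h1, h2⟩ := sq_sub_mul_sq_eq_zero hc h
  have aux : ∀ p : F[X], p.eval 0 = 0 → p = X * p.divX := fun p hp => by
    rw [← coeff_zero_eq_eval_zero] at hp
    conv_lhs => rw [← X_mul_divX_add p, hp, C_0, add_zero]
  -- If `t` divides `x`, then `x + yF = (y + (x/t)F)F`.
  refine ⟨⟨w.imJ, w.imK, w.re.divX, w.imI.divX⟩, ?_⟩
  ext1 <;> simp only [polF, QuaternionAlgebra.re_mul, QuaternionAlgebra.imI_mul,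
    QuaternionAlgebra.imJ_mul, QuaternionAlgebra.imK_mul]
  · linear_combination aux _ h1
  · linear_combination aux _ h2
  · ring
  · ring

/-- A reduction `x + yF` of norm zero is annihilated on the left by some `1 - αF`. This makes `(1 -
αF)w` divisible by `t - τ` and drives the descent. -/
lemma exists_evalAt_linear_neg_mul_eq_zero [Fact (¬ IsSquare c)] {τ : Fˣ}
    (hτ : Nonempty (NormFiber c τ)) {w : PolOrd c} (h : (nrd w).IsRoot (τ : F)) :
    ∃ α : NormFiber c τ, evalAt c (τ : F) (linear (-α.1) * w) = 0 := by
  rw [IsRoot.def, ← nrd_evalAt] at h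
  obtain ⟨x, y, hxy⟩ := exists_ofPair (τ : F) (evalAt c (τ : F) w)
  rw [hxy, nrd_ofPair] at h
  simp only [map_mul, hxy, evalAt_linear, ofPair_mul, ofPair_eq_zero]
  by_cases hx : x = 0
  -- Here the reduction is zero and every `α` works; only this case needs the norm fiber to be
  -- inhabited.
  · have hy : y = 0 := by
      rw [hx, QuadraticAlgebra.norm_zero, zero_sub, neg_eq_zero] at h
      exact QuadraticAlgebra.norm_eq_zero_iff_eq_zero.1 ((mul_eq_zero.1 h).resolve_left τ.ne_zero)
    obtain ⟨α⟩ := hτ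
    exact ⟨α, by simp [hx, hy]⟩
  · have hx' : star x ≠ 0 := star_ne_zero.mpr hx
    have hn : QuadraticAlgebra.norm x ≠ 0 := by
      rwa [Ne, QuadraticAlgebra.norm_eq_zero_iff_eq_zero]
    have hyx : y / star x * star x = y := div_mul_cancel₀ _ hx'
    refine ⟨⟨y / star x, ?_⟩, ?_, ?_⟩
    · have := congrArg QuadraticAlgebra.norm hyx
      rw [map_mul, QuadraticAlgebra.norm_star] at this
      rw [Units.val_inv_eq_inv_val, ← mul_left_inj' hn, this, eq_inv_mul_iff_mul_eq₀ τ.ne_zero]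
      linear_combination -h
    · have e : x * star x = algebraMap F (FZ c) τ * (y * star y) := by
        rw [← QuadraticAlgebra.algebraMap_norm_eq_mul_star,
          ← QuadraticAlgebra.algebraMap_norm_eq_mul_star, ← map_mul, ← sub_eq_zero, ← map_sub, h,
          map_zero]
      field_simp
      linear_combination e
    · simp only
      linear_combination -hyx

variable {S₀ : Finset Fˣ}

lemma isUnit_toOrd {w : PolOrd c} (h : IsUnit (algebraMap F[X] (SInt S₀) (nrd w))) :
    IsUnit (toOrd c S₀ w) :=
  isUnit_of_isUnit_nrd (by rwa [nrd_toOrd])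

/-- The class `[δ]` of a nonzero constant, multiplicative in `δ`. -/
def constHom (c : F) (S₀ : Finset Fˣ) : (FZ c)ˣ →* Lam c S₀ :=
  (cls c S₀).comp (Units.map (emb c S₀).toMonoidHom)

lemma constHom_apply (δ : (FZ c)ˣ) : constHom c S₀ δ = elD c S₀ δ := rfl

lemma oneAdd_mem_Gam (τ : S₀) (α : NormFiber c (τ : Fˣ)) : oneAdd c S₀ τ α ∈ Gam c S₀ :=
  Subgroup.subset_closure (Set.mem_iUnion.2 ⟨τ, α, rfl⟩)

/-- Descent on the degree of the norm: a root at `0` contributes a right factor `F`, a root at `τ` a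
left factor `1 + αF`. -/
lemma exists_cls_eq_of_val_eq_toOrd [Fact (¬ IsSquare c)]
    (hS : ∀ τ ∈ S₀, Nonempty (NormFiber c τ)) (n : ℕ) :
    ∀ (w : PolOrd c) (u : (Ord c S₀)ˣ), (nrd w).natDegree = n → (u : Ord c S₀) = toOrd c S₀ w →
      ∃ γ ∈ Gam c S₀, ∃ (δ : (FZ c)ˣ) (j : ℕ),
        cls c S₀ u = γ * constHom c S₀ δ * elS c S₀ ^ j := by
  have hc : ¬ IsSquare c := Fact.out
  induction n using Nat.strong_induction_on with
  | _ n ih =>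
  intro w u hn hu
  have hw : IsUnit (algebraMap F[X] (SInt S₀) (nrd w)) := by
    rw [← nrd_toOrd, ← hu]
    exact u.isUnit.map nrd
  have hw0 : nrd w ≠ 0 := by
    intro h0
    rw [h0, map_zero] at hw
    exact not_isUnit_zero hw
  by_cases hdeg : (nrd w).natDegree = 0
  · obtain ⟨α, rfl⟩ := exists_eq_polConst hc hdeg
    have hα : α ≠ 0 := by
      rintro rfl
      rw [map_zero, nrd_apply] at hw0
      simp at hw0
    refine ⟨1, one_mem _, Units.mk0 α hα, 0, ?_⟩
    rw [pow_zero, mul_one, one_mul]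
    apply cls_eq_cls_of_val_eq
    rw [hu, toOrd_polConst]
    rfl
  rcases exists_root_of_isUnit hw hdeg with h0 | ⟨τ, hτ, hroot⟩
  · obtain ⟨v, rfl⟩ := exists_eq_mul_polF hc h0
    rw [map_mul, nrd_polF] at hn hw hw0
    have hv0 : nrd v ≠ 0 := left_ne_zero_of_mul hw0
    rw [mul_neg, natDegree_neg, natDegree_mul_X hv0] at hn
    rw [map_mul] at hw
    have hv := isUnit_toOrd (isUnit_of_mul_isUnit_left hw)
    obtain ⟨γ, hγ, δ, j, h⟩ := ih (nrd v).natDegree (by omega) v hv.unit rfl rfl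
    refine ⟨γ, hγ, δ, j + 1, ?_⟩
    rw [pow_succ, ← mul_assoc, ← h, elS, ← map_mul]
    apply cls_eq_cls_of_val_eq
    rw [hu, map_mul, toOrd_polF]
    rfl
  · obtain ⟨α, hα⟩ := exists_evalAt_linear_neg_mul_eq_zero (hS τ hτ) hroot
    obtain ⟨v, hv⟩ := exists_eq_mul_of_evalAt_eq_zero hα
    have hnrd := congrArg nrd hv
    rw [map_mul, map_mul, nrd_algebraMap, nrd_linear, QuadraticAlgebra.norm_neg, α.2] at hnrd
    have e1 : (1 - C (((τ⁻¹ : Fˣ) : F)) * X : F[X]) = C (-((τ⁻¹ : Fˣ) : F)) * (X - C (τ : F)) := by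
      have : C (((τ⁻¹ : Fˣ) : F)) * C (τ : F) = 1 := by
        rw [← C_mul, Units.inv_mul, C_1]
      rw [C_neg]
      linear_combination -this
    have hX : (X - C (τ : F)) ≠ 0 := X_sub_C_ne_zero _
    -- On norms, `(1 - αF)w = (t - τ)v` reads `-τ⁻¹(t - τ) nrd w = (t - τ)² nrd v`. Cancelling one
    -- factor shows that `nrd v` has degree one less than `nrd w`.
    have e2 : C (-((τ⁻¹ : Fˣ) : F)) * nrd w = (X - C (τ : F)) * nrd v := by
      apply mul_left_cancel₀ hX
      rw [e1] at hnrd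
      linear_combination hnrd
    have hCne : (-((τ⁻¹ : Fˣ) : F)) ≠ 0 := neg_ne_zero.2 (Units.ne_zero _)
    have hvunit : IsUnit (algebraMap F[X] (SInt S₀) (nrd v)) := by
      have h1 : IsUnit (algebraMap F[X] (SInt S₀) ((X - C (τ : F)) * nrd v)) := by
        rw [← e2, map_mul]
        exact ((isUnit_C.2 hCne.isUnit).map _).mul hw
      rw [map_mul] at h1
      exact isUnit_of_mul_isUnit_right h1
    have hv0 : nrd v ≠ 0 := by
      intro h0
      rw [h0, map_zero] at hvunit
      exact not_isUnit_zero hvunit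
    have hdegv : (nrd v).natDegree + 1 = n := by
      have := congrArg natDegree e2
      rw [natDegree_C_mul hCne, natDegree_mul hX hv0, natDegree_X_sub_C] at this
      omega
    obtain ⟨γ, hγ, δ, j, h⟩ :=
      ih (nrd v).natDegree (by omega) v (isUnit_toOrd hvunit).unit rfl rfl
    -- From `(1 - αF)w = (t - τ)v` one gets `[w] = [1 - αF]⁻¹[v] = [1 + αF][v]`.
    refine ⟨oneAdd c S₀ ⟨τ, hτ⟩ α * γ, mul_mem (oneAdd_mem_Gam _ _) hγ, δ, j, ?_⟩
    rw [mul_assoc, mul_assoc, ← mul_assoc γ, ← h, ← inv_mul_eq_iff_eq_mul,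
      inv_eq_of_mul_eq_one_right (oneAdd_mul_oneAdd_neg ⟨τ, hτ⟩ α), oneAdd_eq_cls, ← map_mul,
      eq_comm, cls_eq_iff]
    refine ⟨(isUnit_tt_sub S₀ ⟨τ, hτ⟩).unit, ?_⟩
    rw [Units.val_mul, linUnit_val, hu, ← map_mul]
    change _ = toOrd c S₀ (linear (-α.1) * w)
    rw [hv, map_mul, toOrd_algebraMap, map_sub]
    rfl

theorem exists_eq_mul_constHom_mul_elS_pow [Fact (¬ IsSquare c)]
    (hS : ∀ τ ∈ S₀, Nonempty (NormFiber c τ)) (g : Lam c S₀) :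
    ∃ γ ∈ Gam c S₀, ∃ (δ : (FZ c)ˣ) (j : ℕ), g = γ * constHom c S₀ δ * elS c S₀ ^ j := by
  obtain ⟨u, rfl⟩ := cls_surjective g
  obtain ⟨p1, q1, hp1, h1⟩ := exists_isUnit_mul_eq_algebraMap (S₀ := S₀) (u : Ord c S₀).re
  obtain ⟨p2, q2, hp2, h2⟩ := exists_isUnit_mul_eq_algebraMap (S₀ := S₀) (u : Ord c S₀).imI
  obtain ⟨p3, q3, hp3, h3⟩ := exists_isUnit_mul_eq_algebraMap (S₀ := S₀) (u : Ord c S₀).imJ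
  obtain ⟨p4, q4, hp4, h4⟩ := exists_isUnit_mul_eq_algebraMap (S₀ := S₀) (u : Ord c S₀).imK
  have hr : IsUnit (algebraMap F[X] (SInt S₀) (p1 * p2 * p3 * p4)) := by
    simp only [map_mul]
    exact ((hp1.mul hp2).mul hp3).mul hp4
  have hw : algebraMap (SInt S₀) (Ord c S₀) (algebraMap F[X] (SInt S₀) (p1 * p2 * p3 * p4)) *
      (u : Ord c S₀) = toOrd c S₀ ⟨p2 * p3 * p4 * q1, p1 * p3 * p4 * q2, p1 * p2 * p4 * q3,
        p1 * p2 * p3 * q4⟩ := by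
    rw [← Algebra.smul_def]
    ext1
    · change algebraMap F[X] (SInt S₀) _ * _ = algebraMap F[X] (SInt S₀) _
      simp only [map_mul, ← h1]; ring
    · change algebraMap F[X] (SInt S₀) _ * _ = algebraMap F[X] (SInt S₀) _
      simp only [map_mul, ← h2]; ring
    · change algebraMap F[X] (SInt S₀) _ * _ = algebraMap F[X] (SInt S₀) _
      simp only [map_mul, ← h3]; ring
    · change algebraMap F[X] (SInt S₀) _ * _ = algebraMap F[X] (SInt S₀) _
      simp only [map_mul, ← h4]; ring
  have hu' : IsUnit (algebraMap (SInt S₀) (Ord c S₀)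
      (algebraMap F[X] (SInt S₀) (p1 * p2 * p3 * p4)) * (u : Ord c S₀)) :=
    (hr.map _).mul u.isUnit
  have key := exists_cls_eq_of_val_eq_toOrd hS _ _ hu'.unit rfl hw
  have e : cls c S₀ u = cls c S₀ hu'.unit := cls_eq_iff.2 ⟨hr.unit, rfl⟩
  rwa [e]

end Generation

/-! ### Normal forms of products of the elements `[1 + αF]` -/

section Freeness

variable {F : Type*} [Field F] {c : F} {S₀ : Finset Fˣ}

/-- A letter: a place `τ ∈ S₀` together with `α ∈ F[Z]` of norm `τ⁻¹`. -/
abbrev Letter (c : F) (S₀ : Finset Fˣ) : Type _ := Σ τ : S₀, NormFiber c (τ : Fˣ)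

lemma ofPair_one_mul_ofPair_ne_zero (τ : F) {α e : FZ c} (he : e ≠ 0) :
    ofPair τ 1 α * ofPair τ e 0 ≠ 0 := by
  rw [ofPair_mul, Ne, ofPair_eq_zero]
  simp [he]

/-- At `t = τ` one has `(1 + αF)(1 + βF) = (1 + αF)(1 + ταβ̄)`, and the constant `1 + ταβ̄` vanishes
only for `β = -α`. So a reduced word collapses to its first letter times a nonzero constant, and in
particular it does not vanish. -/
lemma exists_evalAt_prod_eq [Fact (¬ IsSquare c)] {τ : Fˣ} (α : NormFiber c τ)
    (v : List (NormFiber c τ)) (hv : (α :: v).IsChain fun x y => y ≠ x.neg) :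
    ∃ e : FZ c, e ≠ 0 ∧ evalAt c (τ : F) ((α :: v).map fun x => linear x.1).prod =
      ofPair (τ : F) 1 α.1 * ofPair (τ : F) e 0 := by
  induction v generalizing α with
  | nil =>
    refine ⟨1, one_ne_zero, ?_⟩
    simp [evalAt_linear, ofPair_mul]
  | cons β v ih =>
    rw [List.isChain_cons_cons] at hv
    obtain ⟨e, he, h⟩ := ih β hv.2
    have hN : algebraMap F (FZ c) (τ : F) * (α.1 * star α.1) = 1 := by
      rw [← QuadraticAlgebra.algebraMap_norm_eq_mul_star, ← map_mul, α.2, Units.mul_inv, map_one]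
    have hα : star α.1 ≠ 0 := star_ne_zero.mpr (ne_zero_of_norm α)
    have hne : 1 + algebraMap F (FZ c) (τ : F) * α.1 * star β.1 ≠ 0 := by
      intro h0
      apply hv.1
      -- Multiply `1 + ταβ̄ = 0` by `ᾱ` and use `ταᾱ = 1`.
      have h1 : star α.1 + star β.1 = 0 := by
        linear_combination star α.1 * h0 - star β.1 * hN
      rw [← star_add, star_eq_zero] at h1
      exact Subtype.ext (eq_neg_of_add_eq_zero_right h1)
    refine ⟨(1 + algebraMap F (FZ c) (τ : F) * α.1 * star β.1) * e, mul_ne_zero hne he, ?_⟩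
    rw [List.map_cons, List.prod_cons, map_mul, h, evalAt_linear, ← mul_assoc, ofPair_mul,
      ofPair_mul, ofPair_mul]
    congr 1
    · simp
    · simp only [star_mul', star_add, star_one, star_star, mul_zero, zero_add, one_mul]
      have : star (algebraMap F (FZ c) (τ : F)) = algebraMap F (FZ c) (τ : F) := by
        ext <;> simp
      rw [this]
      linear_combination (-β.1 * star e) * hN

/-- The unit of the order spelled by a list of letters. -/
def wordUnit (l : List (Letter c S₀)) : (Ord c S₀)ˣ := (l.map fun x => linUnit S₀ x.1 x.2).prod

/-- The polynomial quaternion spelled by a list of letters. -/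
def wordPol (l : List (Letter c S₀)) : PolOrd c := (l.map fun x => linear x.2.1).prod

lemma wordUnit_val (l : List (Letter c S₀)) : (wordUnit l : Ord c S₀) = toOrd c S₀ (wordPol l) := by
  induction l with
  | nil => simp [wordUnit, wordPol]
  | cons x l ih =>
    simp only [wordUnit, wordPol, List.map_cons, List.prod_cons, Units.val_mul, map_mul] at ih ⊢
    rw [ih, linUnit_val]

lemma eval_nrd_wordPol_ne_zero (τ : S₀) (l : List (Letter c S₀)) (hl : ∀ x ∈ l, x.1 ≠ τ) :
    (nrd (wordPol l)).eval ((τ : Fˣ) : F) ≠ 0 := by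
  induction l with
  | nil => simp [wordPol]
  | cons x l ih =>
    have h1 := ih fun y hy => hl y (List.mem_cons_of_mem _ hy)
    have h2 := hl x List.mem_cons_self
    rw [wordPol, List.map_cons, List.prod_cons, map_mul, eval_mul, nrd_linear, x.2.2]
    refine mul_ne_zero ?_ h1
    simp only [eval_sub, eval_one, eval_mul, eval_C, eval_X]
    intro h0
    apply h2
    have h3 : (((x.1 : Fˣ)⁻¹ : Fˣ) : F) * ((τ : Fˣ) : F) = 1 := (sub_eq_zero.1 h0).symm
    rw [← Units.val_mul, Units.val_eq_one, inv_mul_eq_one] at h3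
    exact Subtype.ext h3

lemma isUnit_evalAt {τ : F} {w : PolOrd c} (h : (nrd w).eval τ ≠ 0) :
    IsUnit (evalAt c τ w) :=
  isUnit_of_isUnit_nrd (by rw [nrd_evalAt]; exact h.isUnit)

/-- A product of letters whose letters at the place `τ` form a nonempty reduced word at its end is
not inverse to an element of `Λ_S` that is a unit at `τ`. -/
lemma cls_wordUnit_mul_ne_one [Fact (¬ IsSquare c)] (τ : S₀) (l : List (Letter c S₀))
    (hl : ∀ x ∈ l, x.1 ≠ τ) (α : NormFiber c (τ : Fˣ)) (v : List (NormFiber c (τ : Fˣ)))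
    (hv : (α :: v).IsChain fun x y => y ≠ x.neg) (b : (Ord c S₀)ˣ) (wb : PolOrd c)
    (hb : (b : Ord c S₀) = toOrd c S₀ wb) (hwb : (nrd wb).eval ((τ : Fˣ) : F) ≠ 0) :
    cls c S₀ (wordUnit l * wordUnit ((α :: v).map (Sigma.mk τ)) * b) ≠ 1 := by
  intro h
  obtain ⟨r, hr⟩ := cls_eq_one_iff.1 h
  set V : PolOrd c := wordPol (((α :: v).map (Sigma.mk τ)) : List (Letter c S₀)) with hV
  set W : PolOrd c := wordPol l * V * wb with hW
  have hr' : toOrd c S₀ W = algebraMap (SInt S₀) (Ord c S₀) r := by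
    rw [← hr, Units.val_mul, Units.val_mul, wordUnit_val, wordUnit_val, hb, hW, map_mul, map_mul]
  have hWs : W = algebraMap F[X] (PolOrd c) W.re := by
    have hinj := algebraMap_sInt_injective (S₀ := S₀)
    ext1
    · rfl
    · exact hinj ((congrArg QuaternionAlgebra.imI hr').trans (map_zero _).symm)
    · exact hinj ((congrArg QuaternionAlgebra.imJ hr').trans (map_zero _).symm)
    · exact hinj ((congrArg QuaternionAlgebra.imK hr').trans (map_zero _).symm)
  have hVe : V = ((α :: v).map fun x => linear x.1).prod := by
    rw [hV, wordPol, List.map_map]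
    rfl
  obtain ⟨e, he, hVev⟩ := exists_evalAt_prod_eq α v hv
  rw [← hVe] at hVev
  have hVn : (nrd V).eval ((τ : Fˣ) : F) = 0 := by
    rw [← nrd_evalAt, hVev, map_mul, nrd_ofPair, α.2, QuadraticAlgebra.norm_one, Units.mul_inv,
      sub_self, zero_mul]
  have hWn : (nrd W).eval ((τ : Fˣ) : F) = 0 := by
    rw [hW, map_mul, map_mul, eval_mul, eval_mul, hVn, mul_zero, zero_mul]
  -- `W` is a scalar polynomial, so `nrd W` is its square. A zero of the norm at `τ` therefore makes
  -- `W` itself vanish there, and cancelling the outer factors, invertible at `τ`, contradicts `V(τ)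
  -- ≠ 0`.
  have hWre : W.re.eval ((τ : Fˣ) : F) = 0 := by
    rw [hWs, nrd_algebraMap, eval_pow] at hWn
    simpa using hWn
  have hW0 : evalAt c ((τ : Fˣ) : F) W = 0 := by
    rw [hWs]
    have := qmap_algebraMap (a := C c) (b := X) (a' := c) (b' := ((τ : Fˣ) : F))
      (evalRingHom ((τ : Fˣ) : F)) (by simp) (by simp) W.re
    refine this.trans ?_
    rw [coe_evalRingHom, hWre, map_zero]
  rw [hW, map_mul, map_mul, (isUnit_evalAt hwb).mul_left_eq_zero,
    (isUnit_evalAt (eval_nrd_wordPol_ne_zero τ l hl)).mul_right_eq_zero, hVev] at hW0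
  exact ofPair_one_mul_ofPair_ne_zero _ he hW0

/-! ### Rewriting words in a group over `Λ_S` -/

section Words

variable {Q : Type*} [Group Q]
  (P : ∀ τ : S₀, NormFiber c (τ : Fˣ) → Q)

/-- The product in `Q` of a list of letters. -/
def wordProd (l : List (Letter c S₀)) : Q := (l.map fun x => P x.1 x.2).prod

lemma wordProd_cons (x : Letter c S₀) (l : List (Letter c S₀)) :
    wordProd P (x :: l) = P x.1 x.2 * wordProd P l := by
  simp [wordProd]

lemma wordProd_append (l m : List (Letter c S₀)) :
    wordProd P (l ++ m) = wordProd P l * wordProd P m := by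
  simp [wordProd]

lemma map_wordProd (φ : Q →* Lam c S₀) (hφ : ∀ τ α, φ (P τ α) = oneAdd c S₀ τ α)
    (l : List (Letter c S₀)) : φ (wordProd P l) = cls c S₀ (wordUnit l) := by
  simp only [wordProd, wordUnit, map_list_prod, List.map_map]
  congr 1
  exact List.map_congr_left fun x _ => hφ x.1 x.2

variable (hinv : ∀ (τ : S₀) (α : NormFiber c (τ : Fˣ)), P τ α * P τ α.neg = 1)

include hinv in
lemma isChain_or_exists_shorter (τ : S₀) (v : List (NormFiber c (τ : Fˣ))) :
    (v.IsChain fun x y => y ≠ x.neg) ∨ ∃ v' : List (NormFiber c (τ : Fˣ)),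
      v'.length < v.length ∧
        wordProd P (v.map (Sigma.mk τ)) = wordProd P (v'.map (Sigma.mk τ)) := by
  induction v with
  | nil => exact Or.inl List.isChain_nil
  | cons α v ih =>
    rcases ih with h | ⟨v', h1, h2⟩
    · cases v with
      | nil => exact Or.inl (List.isChain_singleton _)
      | cons β v =>
        by_cases hβ : β = α.neg
        · refine Or.inr ⟨v, by simp, ?_⟩
          rw [List.map_cons, List.map_cons, wordProd_cons, wordProd_cons, ← mul_assoc, hβ,
            hinv, one_mul]
        · exact Or.inl (List.isChain_cons_cons.2 ⟨hβ, h⟩)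
    · refine Or.inr ⟨α :: v', by simpa using h1, ?_⟩
      rw [List.map_cons, List.map_cons, wordProd_cons, wordProd_cons, h2]

include hinv in
lemma exists_wordProd_eq {g : Q} (hg : g ∈ Subgroup.closure (⋃ τ : S₀, Set.range (P τ))) :
    ∃ l : List (Letter c S₀), g = wordProd P l := by
  induction hg using Subgroup.closure_induction_left with
  | one => exact ⟨[], by simp [wordProd]⟩
  | mul_left x hx y _ ih =>
    obtain ⟨l, rfl⟩ := ih
    obtain ⟨τ, α, rfl⟩ := Set.mem_iUnion.1 hx
    exact ⟨⟨τ, α⟩ :: l, by rw [wordProd_cons]⟩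
  | inv_mul_cancel x hx y _ ih =>
    obtain ⟨l, rfl⟩ := ih
    obtain ⟨τ, α, rfl⟩ := Set.mem_iUnion.1 hx
    exact ⟨⟨τ, α.neg⟩ :: l, by rw [wordProd_cons, inv_eq_of_mul_eq_one_right (hinv τ α)]⟩

variable [Fact (¬ IsSquare c)]
  (hsq : ∀ (τ σ : S₀) (h : (τ : Fˣ) ≠ (σ : Fˣ)) (α : NormFiber c (τ : Fˣ))
    (β : NormFiber c (σ : Fˣ)),
    P τ α * P σ β = P σ (zetaMul h α β) * P τ (zetaMul h.symm β α))

-- The square relation carries a letter at `τ` past letters at other places. Both letters change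
-- within their norm fibers, but the places and the number of letters are kept.
include hsq in
lemma exists_push (τ : S₀) (α : NormFiber c (τ : Fˣ)) (l : List (Letter c S₀))
    (hl : ∀ x ∈ l, x.1 ≠ τ) :
    ∃ (l' : List (Letter c S₀)) (β : NormFiber c (τ : Fˣ)), (∀ x ∈ l', x.1 ≠ τ) ∧
      l'.length = l.length ∧ P τ α * wordProd P l = wordProd P l' * P τ β := by
  induction l generalizing α with
  | nil => exact ⟨[], α, by simp, rfl, by simp [wordProd]⟩
  | cons x l ih =>
    have hx : (τ : Fˣ) ≠ (x.1 : Fˣ) := fun h => hl x List.mem_cons_self (Subtype.ext h.symm)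
    obtain ⟨l', β, h1, h2, h3⟩ := ih (zetaMul hx.symm x.2 α)
      fun y hy => hl y (List.mem_cons_of_mem _ hy)
    refine ⟨⟨x.1, zetaMul hx α x.2⟩ :: l', β, ?_, by simp [h2], ?_⟩
    · intro y hy
      rcases List.mem_cons.1 hy with rfl | hy
      · exact hl x List.mem_cons_self
      · exact h1 y hy
    · rw [wordProd_cons, wordProd_cons, ← mul_assoc, hsq τ x.1 hx, mul_assoc, h3, mul_assoc]

-- All letters at `τ` are collected at the right end without changing the length. The third clause
-- guarantees that none is lost, so the collected part is nonempty if `τ` occurs in `l`.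
include hsq in
lemma exists_sort (τ : S₀) (l : List (Letter c S₀)) :
    ∃ (u : List (Letter c S₀)) (v : List (NormFiber c (τ : Fˣ))), (∀ x ∈ u, x.1 ≠ τ) ∧
      u.length + v.length = l.length ∧ (v = [] → ∀ x ∈ l, x.1 ≠ τ) ∧
      wordProd P l = wordProd P u * wordProd P (v.map (Sigma.mk τ)) := by
  induction l with
  | nil => exact ⟨[], [], by simp, rfl, by simp, by simp [wordProd]⟩
  | cons x l ih =>
    obtain ⟨u, v, h1, h2, h3, h4⟩ := ih
    obtain ⟨σ, α⟩ := x
    by_cases hx : σ = τ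
    · subst hx
      obtain ⟨u', β, g1, g2, g3⟩ := exists_push P hsq σ α u h1
      refine ⟨u', β :: v, g1, by simp [g2, ← h2]; omega, by simp, ?_⟩
      rw [wordProd_cons, h4, ← mul_assoc, g3, List.map_cons, wordProd_cons, mul_assoc]
    · refine ⟨⟨σ, α⟩ :: u, v, ?_, by simp [← h2]; omega, ?_, ?_⟩
      · intro y hy
        rcases List.mem_cons.1 hy with rfl | hy
        · exact hx
        · exact h1 y hy
      · intro hv y hy
        rcases List.mem_cons.1 hy with rfl | hy
        · exact hx
        · exact h3 hv y hy
      · rw [wordProd_cons, wordProd_cons, h4, mul_assoc]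

variable (φ : Q →* Lam c S₀) (hφ : ∀ τ α, φ (P τ α) = oneAdd c S₀ τ α)

include hinv hsq hφ in
/-- In a group `Q` over `Λ_S` in which the letters satisfy the inverse and square relations, a
product of letters is determined to be trivial by its image in `Λ_S` modulo `Λ_B`. -/
theorem eq_one_of_map_mul_cls_eq_one (b : (Ord c S₀)ˣ) (wb : PolOrd c)
    (hb : (b : Ord c S₀) = toOrd c S₀ wb)
    (hwb : ∀ τ : S₀, (nrd wb).eval ((τ : Fˣ) : F) ≠ 0) {g : Q}
    (hg : g ∈ Subgroup.closure (⋃ τ : S₀, Set.range (P τ))) (h : φ g * cls c S₀ b = 1) :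
    g = 1 := by
  obtain ⟨l, rfl⟩ := exists_wordProd_eq P hinv hg
  clear hg
  obtain ⟨n, hn⟩ : ∃ n, l.length = n := ⟨_, rfl⟩
  induction n using Nat.strong_induction_on generalizing l with
  | _ n ih =>
  cases l with
  | nil => simp [wordProd]
  | cons x l =>
    -- Sorting by the place of the first letter makes `v` nonempty. A reduced `v` contradicts the
    -- hypothesis on the image, whatever `u` is; otherwise a cancellation in `v` shortens the word.
    obtain ⟨u, v, h1, h2, h3, h4⟩ := exists_sort P hsq x.1 (x :: l)
    rcases isChain_or_exists_shorter P hinv x.1 v with hv | ⟨v', g1, g2⟩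
    · cases v with
      | nil => exact absurd rfl (h3 rfl x List.mem_cons_self)
      | cons α v =>
        rw [h4, map_mul, map_wordProd P φ hφ, map_wordProd P φ hφ, ← map_mul, ← map_mul] at h
        exact absurd h (cls_wordUnit_mul_ne_one x.1 u h1 α v hv b wb hb (hwb x.1))
    · have e : wordProd P (x :: l) = wordProd P (u ++ v'.map (Sigma.mk x.1)) := by
        rw [h4, g2, wordProd_append]
      rw [e] at h ⊢
      exact ih _ (by rw [← hn, ← h2]; simp; omega) _ h rfl

end Words

end Freeness

/-! ### The subgroup `Λ_B` and its action on `Γ_S` -/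

/-! ### Normalizers of generated subgroups and words in a dihedral group -/

section Group

variable {G : Type*} [Group G]

lemma mem_normalizer_closure {s : Set G} {x : G} (h : ∀ y ∈ s, x * y * x⁻¹ ∈ s)
    (h' : ∀ y ∈ s, x⁻¹ * y * x ∈ s) : x ∈ Subgroup.normalizer (Subgroup.closure s : Set G) := by
  have aux : ∀ z : G, (∀ y ∈ s, z * y * z⁻¹ ∈ s) → ∀ y ∈ Subgroup.closure s,
      z * y * z⁻¹ ∈ Subgroup.closure s := by
    intro z hz y hy
    have h1 : Subgroup.closure s ≤ (Subgroup.closure s).comap (MulAut.conj z).toMonoidHom := by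
      rw [Subgroup.closure_le]
      exact fun y hy => Subgroup.subset_closure (hz y hy)
    exact h1 hy
  rw [Subgroup.mem_normalizer_iff]
  intro y
  refine ⟨aux x h y, fun hy => ?_⟩
  have := aux x⁻¹ (by simpa using h') _ hy
  simpa [mul_assoc] using this

lemma inv_eq_self_of_sq_eq_one {S : G} (hS : S ^ 2 = 1) : S⁻¹ = S :=
  inv_eq_of_mul_eq_one_right (by rw [← sq, hS])

lemma mul_mul_inv_eq_inv {D S : G} (hS : S ^ 2 = 1) (hSD : (S * D) ^ 2 = 1) :
    S * D * S⁻¹ = D⁻¹ := by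
  rw [inv_eq_self_of_sq_eq_one hS, eq_inv_iff_mul_eq_one, mul_assoc, ← sq, hSD]

lemma exists_zpow_mul_pow {D S : G} (hS : S ^ 2 = 1) (hSD : (S * D) ^ 2 = 1) {g : G}
    (hg : g ∈ Subgroup.closure {D, S}) : ∃ (k : ℤ) (j : ℕ), g = D ^ k * S ^ j := by
  have hconj : ∀ k : ℤ, S * D ^ k = D ^ (-k) * S := by
    intro k
    rw [← mul_inv_eq_iff_eq_mul, ← conj_zpow, mul_mul_inv_eq_inv hS hSD, inv_zpow, zpow_neg]
  have hSmul : ∀ (k : ℤ) (j : ℕ), S * (D ^ k * S ^ j) = D ^ (-k) * S ^ (j + 1) := by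
    intro k j
    rw [← mul_assoc, hconj, mul_assoc, pow_succ']
  induction hg using Subgroup.closure_induction_left with
  | one => exact ⟨0, 0, by simp⟩
  | mul_left x hx y _ ih =>
    obtain ⟨k, j, rfl⟩ := ih
    rcases hx with rfl | rfl
    · exact ⟨1 + k, j, by rw [zpow_one_add, mul_assoc]⟩
    · exact ⟨-k, j + 1, hSmul k j⟩
  | inv_mul_cancel x hx y _ ih =>
    obtain ⟨k, j, rfl⟩ := ih
    rcases hx with rfl | rfl
    · exact ⟨-1 + k, j, by rw [zpow_add, zpow_neg_one, mul_assoc]⟩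
    · exact ⟨-k, j + 1, by rw [inv_eq_self_of_sq_eq_one hS]; exact hSmul k j⟩

end Group

/-! ### Classes of constants and of `F` -/

section Constants

variable {F : Type*} [Field F] {c : F} {S₀ : Finset Fˣ}

variable (c) in
/-- The subgroup `Fˣ` of `F[Z]ˣ`. -/
def baseUnits : Subgroup (FZ c)ˣ := (Units.map (algebraMap F (FZ c)).toMonoidHom).range

lemma mem_baseUnits_iff {e : (FZ c)ˣ} : e ∈ baseUnits c ↔ (e : FZ c).im = 0 := by
  constructor
  · rintro ⟨a, rfl⟩
    rfl
  · intro h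
    have he : (e : FZ c) = algebraMap F (FZ c) (e : FZ c).re := by
      ext
      · rfl
      · exact h
    have h0 : (e : FZ c).re ≠ 0 := by
      intro h0
      rw [h0, map_zero] at he
      exact e.ne_zero he
    exact ⟨Units.mk0 _ h0, Units.ext he.symm⟩

lemma constHom_eq_one_iff {e : (FZ c)ˣ} : constHom c S₀ e = 1 ↔ e ∈ baseUnits c := by
  rw [constHom, MonoidHom.comp_apply, cls_eq_one_iff, mem_baseUnits_iff]
  have hinj : Function.Injective (const S₀ : F →+* SInt S₀) := (const S₀).injective
  constructor
  · rintro ⟨r, hr⟩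
    have : const S₀ (e : FZ c).im = 0 := congrArg QuaternionAlgebra.imI hr
    exact hinj (this.trans (map_zero _).symm)
  · intro h
    have h0 : (e : FZ c).re ≠ 0 := by
      intro h0
      exact e.ne_zero (QuadraticAlgebra.ext h0 h)
    refine ⟨(isUnit_const S₀ (Units.mk0 _ h0)).unit, ?_⟩
    refine QuaternionAlgebra.ext rfl ?_ rfl rfl
    exact (congrArg (const S₀) h).trans (map_zero _)

lemma elS_sq : elS c S₀ ^ 2 = 1 := by
  rw [elS, ← map_pow, cls_eq_one_iff]
  refine ⟨(isUnit_tt S₀).unit, ?_⟩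
  change elF c S₀ ^ 2 = algebraMap _ _ (tt S₀)
  rw [sq]
  ext1 <;> simp [elF, QuaternionAlgebra.algebraMap_eq]

lemma elS_inv : (elS c S₀)⁻¹ = elS c S₀ := inv_eq_self_of_sq_eq_one elS_sq

/-- The unit `ē` of `F[Z]`. -/
def starUnit (e : (FZ c)ˣ) : (FZ c)ˣ := Units.map (starRingEnd (FZ c)).toMonoidHom e

lemma starUnit_val (e : (FZ c)ˣ) : (starUnit e : FZ c) = star (e : FZ c) := rfl

lemma polF_mul_polConst (α : FZ c) : polF c * polConst α = polConst (star α) * polF c := by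
  ext1 <;> simp [polF, polConst]

lemma elF_mul_emb (α : FZ c) : elF c S₀ * emb c S₀ α = emb c S₀ (star α) * elF c S₀ := by
  rw [← toOrd_polF, ← toOrd_polConst, ← toOrd_polConst, ← map_mul, polF_mul_polConst, map_mul]

lemma elS_mul_constHom (e : (FZ c)ˣ) :
    elS c S₀ * constHom c S₀ e = constHom c S₀ (starUnit e) * elS c S₀ := by
  rw [elS, constHom, MonoidHom.comp_apply, MonoidHom.comp_apply, ← map_mul, ← map_mul]
  exact cls_eq_cls_of_val_eq (elF_mul_emb (e : FZ c))

/-- The product `eē = N(e)` is a scalar. -/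
lemma constHom_starUnit (e : (FZ c)ˣ) : constHom c S₀ (starUnit e) = (constHom c S₀ e)⁻¹ := by
  rw [eq_inv_iff_mul_eq_one, ← map_mul, constHom_eq_one_iff, mem_baseUnits_iff, Units.val_mul,
    starUnit_val, mul_comm, ← QuadraticAlgebra.algebraMap_norm_eq_mul_star]
  rfl

lemma elS_mul_constHom_sq (e : (FZ c)ˣ) : (elS c S₀ * constHom c S₀ e) ^ 2 = 1 := by
  rw [sq]
  nth_rewrite 1 [elS_mul_constHom]
  rw [constHom_starUnit, mul_assoc, ← mul_assoc (elS c S₀), ← sq, elS_sq, one_mul,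
    inv_mul_cancel]

/-- The class `[e Fʲ]` has even `j` and `e ∈ F` if it is trivial. -/
lemma even_and_mem_of_constHom_mul_elS_pow_eq_one {e : (FZ c)ˣ} {j : ℕ}
    (h : constHom c S₀ e * elS c S₀ ^ j = 1) : Even j ∧ e ∈ baseUnits c := by
  rcases Nat.even_or_odd j with hj | hj
  · refine ⟨hj, ?_⟩
    obtain ⟨k, rfl⟩ := hj
    rwa [← two_mul, pow_mul, elS_sq, one_pow, mul_one, constHom_eq_one_iff] at h
  · exfalso
    obtain ⟨k, rfl⟩ := hj
    rw [pow_succ, pow_mul, elS_sq, one_pow, one_mul, constHom, MonoidHom.comp_apply, elS,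
      ← map_mul, cls_eq_one_iff] at h
    obtain ⟨r, hr⟩ := h
    have hr' : toOrd c S₀ (polConst (e : FZ c) * polF c) = algebraMap (SInt S₀) (Ord c S₀) r := by
      rw [← hr, map_mul, toOrd_polConst, toOrd_polF]
      rfl
    have hinj := algebraMap_sInt_injective (S₀ := S₀)
    have h1 : (polConst (e : FZ c) * polF c).imJ = 0 :=
      hinj ((congrArg QuaternionAlgebra.imJ hr').trans (map_zero _).symm)
    have h2 : (polConst (e : FZ c) * polF c).imK = 0 :=
      hinj ((congrArg QuaternionAlgebra.imK hr').trans (map_zero _).symm)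
    apply e.ne_zero
    ext
    · simpa [polConst, polF] using h1
    · simpa [polConst, polF] using h2

/-- The element `ᾱ` of the norm fiber. -/
def NormFiber.conj {τ : Fˣ} (α : NormFiber c τ) : NormFiber c τ :=
  ⟨star α.1, by rw [QuadraticAlgebra.norm_star]; exact α.2⟩

lemma elS_mul_oneAdd (τ : S₀) (α : NormFiber c (τ : Fˣ)) :
    elS c S₀ * oneAdd c S₀ τ α * (elS c S₀)⁻¹ = oneAdd c S₀ τ α.conj := by
  rw [mul_inv_eq_iff_eq_mul, elS, oneAdd_eq_cls, oneAdd_eq_cls, ← map_mul, ← map_mul]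
  apply cls_eq_cls_of_val_eq
  rw [Units.val_mul, Units.val_mul, linUnit_val, linUnit_val]
  change elF c S₀ * _ = _ * elF c S₀
  rw [← toOrd_polF, ← map_mul, ← map_mul, linear_eq, linear_eq, mul_add, add_mul, mul_one,
    one_mul, ← mul_assoc, polF_mul_polConst]
  rfl

lemma elS_mem_normalizer : elS c S₀ ∈ Subgroup.normalizer (Gam c S₀ : Set (Lam c S₀)) := by
  have key : ∀ y ∈ ⋃ τ : S₀, PA c S₀ τ,
      elS c S₀ * y * (elS c S₀)⁻¹ ∈ ⋃ τ : S₀, PA c S₀ τ := by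
    intro y hy
    obtain ⟨τ, α, rfl⟩ := Set.mem_iUnion.1 hy
    exact Set.mem_iUnion.2 ⟨τ, α.conj, (elS_mul_oneAdd τ α).symm⟩
  refine mem_normalizer_closure key fun y hy => ?_
  have := key y hy
  rwa [elS_inv] at this ⊢

/-! ### Conjugation by constants as rotation of the norm fibers -/

section Rotation

variable [Fact (¬ IsSquare c)]

lemma star_unit_ne_zero (e : (FZ c)ˣ) : star (e : FZ c) ≠ 0 := star_ne_zero.mpr e.ne_zero

/-- The element `e α / ē`, for `e ∈ F[Z]ˣ`. -/
def rot (e : (FZ c)ˣ) {τ : Fˣ} (α : NormFiber c τ) : NormFiber c τ :=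
  ⟨e * α.1 / star (e : FZ c), by
    have h := congrArg QuadraticAlgebra.norm
      (div_mul_cancel₀ ((e : FZ c) * α.1) (star_unit_ne_zero e))
    have hn : QuadraticAlgebra.norm (e : FZ c) ≠ 0 := by
      rw [Ne, QuadraticAlgebra.norm_eq_zero_iff_eq_zero]
      exact e.ne_zero
    rw [map_mul, map_mul, QuadraticAlgebra.norm_star, mul_comm, mul_right_inj' hn] at h
    rw [h, α.2]⟩

lemma rot_val (e : (FZ c)ˣ) {τ : Fˣ} (α : NormFiber c τ) :
    (rot e α).1 = e * α.1 / star (e : FZ c) := rfl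

lemma rot_eq_iff (e : (FZ c)ˣ) {τ : Fˣ} (α β : NormFiber c τ) :
    rot e α = β ↔ (e : FZ c) * α.1 = β.1 * star (e : FZ c) := by
  rw [Subtype.ext_iff, rot_val, div_eq_iff (star_unit_ne_zero e)]

lemma rot_one {τ : Fˣ} (α : NormFiber c τ) : rot 1 α = α := by
  rw [rot_eq_iff, Units.val_one, star_one, mul_one, one_mul]

lemma rot_mul (e e' : (FZ c)ˣ) {τ : Fˣ} (α : NormFiber c τ) :
    rot (e * e') α = rot e (rot e' α) := by
  have h := star_unit_ne_zero e
  have h' := star_unit_ne_zero e'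
  refine Subtype.ext ?_
  rw [rot_val, rot_val, rot_val, Units.val_mul, star_mul']
  field_simp

lemma constHom_mul_oneAdd (e : (FZ c)ˣ) (τ : S₀) (α : NormFiber c (τ : Fˣ)) :
    constHom c S₀ e * oneAdd c S₀ τ α * (constHom c S₀ e)⁻¹ = oneAdd c S₀ τ (rot e α) := by
  rw [mul_inv_eq_iff_eq_mul, constHom, MonoidHom.comp_apply, oneAdd_eq_cls, oneAdd_eq_cls,
    ← map_mul, ← map_mul]
  apply cls_eq_cls_of_val_eq
  rw [Units.val_mul, Units.val_mul, linUnit_val, linUnit_val]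
  change emb c S₀ e * _ = _ * emb c S₀ e
  rw [← toOrd_polConst, ← map_mul, ← map_mul, linear_eq, linear_eq, mul_add, add_mul, mul_one,
    one_mul, mul_assoc _ (polF c), polF_mul_polConst, ← mul_assoc, ← mul_assoc, ← map_mul,
    ← map_mul, (rot_eq_iff e α _).1 rfl]

/-- Hilbert's Theorem 90 for `F[Z]`: the norm fibers are single orbits. -/
lemma exists_rot_eq {τ : Fˣ} (α β : NormFiber c τ) :
    ∃ e : (FZ c)ˣ, rot e α = β := by
  have hN : β.1 * star β.1 = α.1 * star α.1 := by
    rw [← QuadraticAlgebra.algebraMap_norm_eq_mul_star,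
      ← QuadraticAlgebra.algebraMap_norm_eq_mul_star, α.2, β.2]
  by_cases h : α.1 + β.1 = 0
  -- For `β = -α` the generator `Z` works, since `Z̄ = -Z`.
  · have hZ : (⟨0, 1⟩ : FZ c) ≠ 0 := by
      intro h0
      exact one_ne_zero (congrArg QuadraticAlgebra.im h0)
    refine ⟨Units.mk0 ⟨0, 1⟩ hZ, ?_⟩
    rw [rot_eq_iff, eq_neg_of_add_eq_zero_right h]
    ext <;> simp
  · have hα := star_ne_zero.mpr (ne_zero_of_norm α)
    -- For `e = (α + β)ᾱ`, both `eα` and `βē` equal `(α + β)αᾱ`, because `αᾱ = ββ̄`.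
    refine ⟨Units.mk0 ((α.1 + β.1) * star α.1) (mul_ne_zero h hα), ?_⟩
    rw [rot_eq_iff]
    simp only [Units.val_mk0, star_mul', star_add, star_star]
    linear_combination -α.1 * hN

lemma rot_eq_self_iff (h2 : (2 : F) ≠ 0) (e : (FZ c)ˣ) {τ : Fˣ} (α : NormFiber c τ) :
    rot e α = α ↔ e ∈ baseUnits c := by
  rw [rot_eq_iff, mul_comm, mul_right_inj' (ne_zero_of_norm α), mem_baseUnits_iff]
  constructor
  · intro h
    have h3 : (e : FZ c).im = -(e : FZ c).im := by
      conv_lhs => rw [h]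
      simp
    have h4 : 2 * (e : FZ c).im = 0 := by linear_combination h3
    exact (mul_eq_zero.1 h4).resolve_left h2
  · intro h
    ext <;> simp [h]

lemma constHom_mem_normalizer (e : (FZ c)ˣ) :
    constHom c S₀ e ∈ Subgroup.normalizer (Gam c S₀ : Set (Lam c S₀)) := by
  have key : ∀ (e : (FZ c)ˣ), ∀ y ∈ ⋃ τ : S₀, PA c S₀ τ,
      constHom c S₀ e * y * (constHom c S₀ e)⁻¹ ∈ ⋃ τ : S₀, PA c S₀ τ := by
    intro e y hy
    obtain ⟨τ, α, rfl⟩ := Set.mem_iUnion.1 hy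
    exact Set.mem_iUnion.2 ⟨τ, rot e α, (constHom_mul_oneAdd e τ α).symm⟩
  refine mem_normalizer_closure (key e) fun y hy => ?_
  simpa using key e⁻¹ y hy

theorem Gam_normal (hS : ∀ τ ∈ S₀, Nonempty (NormFiber c τ)) : (Gam c S₀).Normal := by
  rw [← Subgroup.normalizer_eq_top_iff, eq_top_iff]
  intro g _
  obtain ⟨γ, hγ, e, j, rfl⟩ := exists_eq_mul_constHom_mul_elS_pow hS g
  exact mul_mem (mul_mem (Subgroup.le_normalizer hγ) (constHom_mem_normalizer e))
    (pow_mem elS_mem_normalizer j)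

/-- The factorization of `Λ_S` is applied with `S₀ = ∅`, where the subgroup generated by the letters
is trivial. -/
lemma mem_LamB_iff {g : Lam c S₀} :
    g ∈ LamB c S₀ ↔ ∃ (e : (FZ c)ˣ) (j : ℕ), g = constHom c S₀ e * elS c S₀ ^ j := by
  have h1 : ∀ e, inclLam c (Finset.empty_subset S₀) (constHom c ∅ e) = constHom c S₀ e := by
    intro e
    refine cls_eq_cls_of_val_eq ?_
    exact QuaternionAlgebra.ext rfl rfl rfl rfl
  have h2 : inclLam c (Finset.empty_subset S₀) (elS c ∅) = elS c S₀ := by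
    refine cls_eq_cls_of_val_eq ?_
    exact QuaternionAlgebra.ext rfl rfl rfl rfl
  constructor
  · rintro ⟨g, rfl⟩
    obtain ⟨γ, hγ, e, j, rfl⟩ := exists_eq_mul_constHom_mul_elS_pow (S₀ := ∅) (by simp) g
    have h3 : γ = 1 := by
      have : Gam c (∅ : Finset Fˣ) = ⊥ := by
        rw [Gam, Set.iUnion_of_empty, Subgroup.closure_empty]
      rwa [this, Subgroup.mem_bot] at hγ
    exact ⟨e, j, by rw [map_mul, map_mul, h3, map_one, one_mul, map_pow, h1, h2]⟩
  · rintro ⟨e, j, rfl⟩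
    exact ⟨constHom c ∅ e * elS c ∅ ^ j, by rw [map_mul, map_pow, h1, h2]⟩

/-- A representative of `[e Fʲ]` that is integral and invertible at all `τ ∈ S₀`. -/
lemma exists_constHom_mul_elS_pow_eq_cls (e : (FZ c)ˣ) (j : ℕ) :
    ∃ (b : (Ord c S₀)ˣ) (wb : PolOrd c), constHom c S₀ e * elS c S₀ ^ j = cls c S₀ b ∧
      (b : Ord c S₀) = toOrd c S₀ wb ∧ ∀ τ : S₀, (nrd wb).eval ((τ : Fˣ) : F) ≠ 0 := by
  refine ⟨Units.map (emb c S₀).toMonoidHom e * (isUnit_elF c S₀).unit ^ j,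
    polConst (e : FZ c) * polF c ^ j, ?_, ?_, fun τ => ?_⟩
  · rw [map_mul, map_pow]
    rfl
  · rw [map_mul, map_pow, toOrd_polConst, toOrd_polF]
    rfl
  · rw [map_mul, map_pow, nrd_polConst, nrd_polF]
    simp only [eval_mul, eval_C, eval_pow, eval_neg, eval_X]
    refine mul_ne_zero ?_ (pow_ne_zero _ (neg_ne_zero.2 (Units.ne_zero _)))
    rw [Ne, QuadraticAlgebra.norm_eq_zero_iff_eq_zero]
    exact e.ne_zero

theorem isComplement'_Gam_LamB (hS : ∀ τ ∈ S₀, Nonempty (NormFiber c τ)) :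
    Subgroup.IsComplement' (Gam c S₀) (LamB c S₀) := by
  apply Subgroup.isComplement'_of_disjoint_and_mul_eq_univ
  · rw [Subgroup.disjoint_def]
    intro g hg hB
    obtain ⟨e, j, he⟩ := mem_LamB_iff.1 (inv_mem hB)
    obtain ⟨b, wb, h1, h2, h3⟩ := exists_constHom_mul_elS_pow_eq_cls (S₀ := S₀) e j
    -- The case `Q = Λ_S`, `φ = id`: `g` lies in `Γ_S`, and its inverse has a representative from
    -- `Λ_B` that is invertible at every `τ ∈ S₀`.
    refine eq_one_of_map_mul_cls_eq_one (oneAdd c S₀) oneAdd_mul_oneAdd_neg oneAdd_mul_oneAdd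
      (MonoidHom.id _) (fun _ _ => rfl) b wb h2 h3 hg ?_
    rw [← h1, ← he, MonoidHom.id_apply, mul_inv_cancel]
  · rw [Set.eq_univ_iff_forall]
    intro g
    obtain ⟨γ, hγ, e, j, rfl⟩ := exists_eq_mul_constHom_mul_elS_pow hS g
    exact ⟨γ, hγ, _, mem_LamB_iff.2 ⟨e, j, rfl⟩, (mul_assoc _ _ _).symm⟩

end Rotation

theorem inclLam_injective {T₀ : Finset Fˣ} (h : T₀ ⊆ S₀) :
    Function.Injective (inclLam c h) := by
  have hinj : Function.Injective (inclInt h) := by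
    intro x y hxy
    have hxy' := congrArg Subtype.val hxy
    exact Subtype.ext hxy'
  rw [injective_iff_map_eq_one]
  intro g hg
  obtain ⟨u, rfl⟩ := cls_surjective g
  have hg' : cls c S₀ (Units.map (inclOrd c h).toMonoidHom u) = 1 := hg
  rw [cls_eq_one_iff] at hg' ⊢
  obtain ⟨r, hr⟩ := hg'
  have hu : (u : Ord c T₀) = algebraMap (SInt T₀) (Ord c T₀) (u : Ord c T₀).re := by
    ext1
    · rfl
    · exact hinj ((congrArg QuaternionAlgebra.imI hr).trans (map_zero _).symm)
    · exact hinj ((congrArg QuaternionAlgebra.imJ hr).trans (map_zero _).symm)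
    · exact hinj ((congrArg QuaternionAlgebra.imK hr).trans (map_zero _).symm)
  -- The scalar is a priori invertible only among the `S`-integers. The constant coefficient of
  -- `u⁻¹` provides its inverse among the `T`-integers.
  have h1 : (u : Ord c T₀).re * ((u⁻¹ : (Ord c T₀)ˣ) : Ord c T₀).re = 1 := by
    have h2 := u.mul_inv
    rw [hu, ← Algebra.smul_def] at h2
    exact congrArg QuaternionAlgebra.re h2
  exact ⟨Units.mkOfMulEqOne _ _ h1, hu⟩

end Constants

/-! ### Powers of a generator of `F[Z]ˣ` -/

section Generator

variable {F : Type*} [Field F] {c : F}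

lemma two_ne_zero_of_not_isSquare [Finite F] (hc : ¬ IsSquare c) : (2 : F) ≠ 0 :=
  Ring.two_ne_zero fun h => hc (FiniteField.isSquare_of_char_two h c)

lemma card_baseUnits : Nat.card (baseUnits c) = Nat.card F - 1 := by
  rw [← Nat.card_units F]
  refine (Nat.card_congr (MonoidHom.ofInjective (f := Units.map _) ?_).toEquiv).symm
  exact Units.map_injective (algebraMap F (FZ c)).injective

instance finite_FZ [Finite F] : Finite (FZ c) :=
  Finite.of_equiv _ (QuadraticAlgebra.equivProd c 0).symm

variable [Fact (¬ IsSquare c)]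

lemma card_units_FZ : Nat.card (FZ c)ˣ = Nat.card F ^ 2 - 1 := by
  rw [Nat.card_units, Nat.card_congr (QuadraticAlgebra.equivProd c 0), Nat.card_prod, sq]

lemma elD_pow_conj {S₀ : Finset Fˣ} (δ : (FZ c)ˣ) (n : ℕ) (τ : S₀) (α : NormFiber c (τ : Fˣ)) :
    elD c S₀ δ ^ n * oneAdd c S₀ τ α * (elD c S₀ δ ^ n)⁻¹ = oneAdd c S₀ τ (rot (δ ^ n) α) := by
  rw [← constHom_mul_oneAdd, map_pow]
  rfl

variable [Finite F] {S₀ : Finset Fˣ}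

lemma card_units_FZ_eq : Nat.card (FZ c)ˣ = (Nat.card F - 1) * (Nat.card F + 1) := by
  have h : 1 < Nat.card F := Finite.one_lt_card
  rw [card_units_FZ]
  obtain ⟨k, hk⟩ := Nat.exists_eq_add_of_lt h
  rw [hk]
  have : (1 + k + 1) ^ 2 = (1 + k + 1 - 1) * (1 + k + 1 + 1) + 1 := by
    rw [Nat.add_sub_cancel]; ring
  omega

lemma index_baseUnits : (baseUnits c).index = Nat.card F + 1 := by
  have h := (baseUnits c).card_mul_index
  rw [card_units_FZ_eq, card_baseUnits] at h
  have h1 : 1 < Nat.card F := Finite.one_lt_card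
  exact Nat.eq_of_mul_eq_mul_left (by omega) h

/-- In the cyclic group `F[Z]ˣ` of order `(q - 1)(q + 1)`, the subgroup `Fˣ` has order `q - 1` and
index `q + 1`. -/
lemma zpow_mem_baseUnits_iff {δ : (FZ c)ˣ} (hδ : ∀ x : (FZ c)ˣ, x ∈ Subgroup.zpowers δ) (n : ℤ) :
    δ ^ n ∈ baseUnits c ↔ ((Nat.card F + 1 : ℕ) : ℤ) ∣ n := by
  have h1 : 1 < Nat.card F := Finite.one_lt_card
  constructor
  · intro h
    have h2 : (δ ^ n) ^ (Nat.card F - 1) = 1 := by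
      rw [← card_baseUnits (c := c)]
      exact congrArg Subtype.val (pow_card_eq_one' (x := (⟨_, h⟩ : baseUnits c)))
    rw [← zpow_natCast, ← zpow_mul, ← orderOf_dvd_iff_zpow_eq_one,
      orderOf_eq_card_of_forall_mem_zpowers hδ, card_units_FZ_eq, Nat.cast_mul, mul_comm] at h2
    exact Int.dvd_of_mul_dvd_mul_right (by omega) h2
  · rintro ⟨k, rfl⟩
    rw [zpow_mul, zpow_natCast]
    refine zpow_mem ?_ k
    rw [← index_baseUnits (c := c)]
    exact Subgroup.pow_index_mem _ δ

variable {δ : (FZ c)ˣ} (hδ : ∀ x : (FZ c)ˣ, x ∈ Subgroup.zpowers δ)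

include hδ

lemma elD_zpow_eq_one_iff (n : ℤ) :
    elD c S₀ δ ^ n = 1 ↔ ((Nat.card F + 1 : ℕ) : ℤ) ∣ n := by
  rw [← zpow_mem_baseUnits_iff hδ, ← constHom_eq_one_iff (S₀ := S₀), map_zpow]
  rfl

lemma orderOf_elD : orderOf (elD c S₀ δ) = Nat.card F + 1 := by
  refine Nat.dvd_antisymm ?_ ?_
  · refine orderOf_dvd_of_pow_eq_one ?_
    rw [← zpow_natCast, elD_zpow_eq_one_iff hδ]
  · have := (elD_zpow_eq_one_iff (S₀ := S₀) hδ (orderOf (elD c S₀ δ))).1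
      (by rw [zpow_natCast, pow_orderOf_eq_one])
    exact_mod_cast this

/-- `z = δ^((q+1)/2)` is not in `F` but `z²` is. Since the `Z`-coefficient of `z²` is twice the
product of the two coefficients of `z`, the element `z` is a multiple of `Z`. -/
lemma star_pow_half (hq : Odd (Nat.card F)) :
    star ((δ ^ ((Nat.card F + 1) / 2) : (FZ c)ˣ) : FZ c) =
      -((δ ^ ((Nat.card F + 1) / 2) : (FZ c)ˣ) : FZ c) := by
  obtain ⟨k, hk⟩ := hq
  have hm : (Nat.card F + 1) / 2 = k + 1 := by omega
  rw [hm]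
  have h1 : δ ^ (k + 1) ∉ baseUnits c := by
    intro h
    have := (zpow_mem_baseUnits_iff hδ ((k + 1 : ℕ) : ℤ)).1 (by rwa [zpow_natCast])
    have := Nat.le_of_dvd (by omega) (Int.natCast_dvd_natCast.1 this)
    omega
  have h2 : δ ^ (k + 1) * δ ^ (k + 1) ∈ baseUnits c := by
    have := (zpow_mem_baseUnits_iff hδ ((k + 1 + (k + 1) : ℕ) : ℤ)).2
      (Int.natCast_dvd_natCast.2 ⟨1, by omega⟩)
    rwa [zpow_natCast, pow_add] at this
  rw [mem_baseUnits_iff] at h1 h2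
  generalize δ ^ (k + 1) = z at h1 h2 ⊢
  rw [Units.val_mul, QuadraticAlgebra.im_mul] at h2
  have h3 : 2 * ((z : FZ c).re * (z : FZ c).im) = 0 := by linear_combination h2
  have h4 : (z : FZ c).re = 0 := by
    have := (mul_eq_zero.1 h3).resolve_left (two_ne_zero_of_not_isSquare (c := c) Fact.out)
    exact (mul_eq_zero.1 this).resolve_right h1
  ext <;> simp [h4]

lemma rot_pow_half (hq : Odd (Nat.card F)) {τ : Fˣ} (α : NormFiber c τ) :
    rot (δ ^ ((Nat.card F + 1) / 2)) α = α.neg := by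
  rw [rot_eq_iff, star_pow_half hδ hq, mul_neg, mul_comm]
  exact (neg_mul_neg _ _).symm.trans (by rw [mul_neg]; rfl)

lemma modEq_of_rot_eq {i j : ℕ} {τ : Fˣ} (α : NormFiber c τ)
    (h : rot (δ ^ i) α = rot (δ ^ j) α) : i ≡ j [MOD Nat.card F + 1] := by
  have h1 : rot ((δ ^ i)⁻¹ * δ ^ j) α = α := by
    rw [rot_mul, ← h, ← rot_mul, inv_mul_cancel, rot_one]
  rw [rot_eq_self_iff (two_ne_zero_of_not_isSquare (c := c) Fact.out), ← zpow_natCast,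
    ← zpow_natCast, ← zpow_neg, ← zpow_add, zpow_mem_baseUnits_iff hδ] at h1
  exact (Nat.modEq_iff_dvd).2 (by rwa [neg_add_eq_sub] at h1)

lemma exists_elD_pow_conj_eq (τ : S₀) (α β : NormFiber c (τ : Fˣ)) :
    ∃ i ≤ Nat.card F, elD c S₀ δ ^ i * oneAdd c S₀ τ α * (elD c S₀ δ ^ i)⁻¹ =
      oneAdd c S₀ τ β := by
  obtain ⟨e, he⟩ := exists_rot_eq α β
  obtain ⟨n, rfl⟩ := mem_powers_iff_mem_zpowers.2 (hδ e)
  refine ⟨n % (Nat.card F + 1), Nat.lt_succ_iff.1 (Nat.mod_lt _ (Nat.succ_pos _)), ?_⟩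
  have := pow_mod_orderOf (elD c S₀ δ) n
  rw [orderOf_elD hδ] at this
  rw [this, elD_pow_conj, ← he]

theorem PA_eq (τ : S₀) (α : NormFiber c (τ : Fˣ)) : PA c S₀ τ =
    {g | ∃ i : ℕ, i ≤ Nat.card F ∧
      g = elD c S₀ δ ^ i * oneAdd c S₀ τ α * (elD c S₀ δ ^ i)⁻¹} := by
  ext g
  constructor
  · rintro ⟨β, rfl⟩
    obtain ⟨i, hi, h⟩ := exists_elD_pow_conj_eq hδ τ α β
    exact ⟨i, hi, h.symm⟩
  · rintro ⟨i, -, rfl⟩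
    exact ⟨_, (elD_pow_conj δ i τ α).symm⟩

/-- Each element is `dⁱsʲ` with `i` unique modulo `q + 1` and `j` unique modulo `2`; the parity of
`j` is visible because a constant times `F` is never a scalar. -/
theorem card_LamB : Nat.card (LamB c S₀) = 2 * (Nat.card F + 1) := by
  have hd : ∀ i : ℕ, elD c S₀ δ ^ i = constHom c S₀ (δ ^ i) := fun i =>
    (map_pow (constHom c S₀) δ i).symm
  let f : Fin (Nat.card F + 1) × Fin 2 → LamB c S₀ := fun x =>
    ⟨elD c S₀ δ ^ (x.1 : ℕ) * elS c S₀ ^ (x.2 : ℕ), mem_LamB_iff.2 ⟨_, _, by rw [hd]⟩⟩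
  have hf : Function.Bijective f := by
    constructor
    · rintro ⟨i, j⟩ ⟨i', j'⟩ h
      have h1 : elD c S₀ δ ^ (i : ℕ) * elS c S₀ ^ (j : ℕ) =
        elD c S₀ δ ^ (i' : ℕ) * elS c S₀ ^ (j' : ℕ) := congrArg Subtype.val h
      have h2 : constHom c S₀ ((δ ^ (i' : ℕ))⁻¹ * δ ^ (i : ℕ)) *
          elS c S₀ ^ ((j : ℕ) + (j' : ℕ)) = 1 := by
        rw [map_mul, map_inv, ← hd, ← hd, pow_add, ← mul_assoc, mul_assoc _ _ (elS c S₀ ^ (j : ℕ)),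
          h1, inv_mul_cancel_left, ← pow_add, ← two_mul, pow_mul, elS_sq, one_pow]
      have h3 := (even_and_mem_of_constHom_mul_elS_pow_eq_one h2).1
      have hj : j = j' := by
        ext
        have := Nat.even_iff.1 h3
        omega
      subst hj
      have h4 := mul_right_cancel h1
      rw [pow_eq_pow_iff_modEq, orderOf_elD hδ] at h4
      have hi : i = i' := Fin.ext (Nat.ModEq.eq_of_lt_of_lt h4 i.2 i'.2)
      rw [hi]
    · rintro ⟨g, hg⟩
      obtain ⟨e, j, rfl⟩ := mem_LamB_iff.1 hg
      obtain ⟨n, rfl⟩ := mem_powers_iff_mem_zpowers.2 (hδ e)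
      refine ⟨⟨⟨n % (Nat.card F + 1), Nat.mod_lt _ (Nat.succ_pos _)⟩,
        ⟨j % 2, Nat.mod_lt _ two_pos⟩⟩, Subtype.ext ?_⟩
      have h1 := pow_mod_orderOf (elD c S₀ δ) n
      rw [orderOf_elD hδ] at h1
      change elD c S₀ δ ^ (n % (Nat.card F + 1)) * elS c S₀ ^ (j % 2) =
        constHom c S₀ (δ ^ n) * elS c S₀ ^ j
      rw [h1, hd, ← pow_eq_pow_mod j elS_sq]
  rw [← Nat.card_congr (Equiv.ofBijective f hf)]
  simp [mul_comm]

end Generator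

/-! ### The presentation of `Λ_S` -/

section PresentationProof

variable {F : Type*} [Field F] [Finite F] {c : F} [Fact (¬ IsSquare c)] {S₀ : Finset Fˣ}
  {δ : (FZ c)ˣ} (hδ : ∀ x : (FZ c)ˣ, x ∈ Subgroup.zpowers δ)
  (α : ∀ τ : S₀, NormFiber c (τ : Fˣ)) {Q : Type*} [Group Q] (D S : Q) (A : S₀ → Q)

/-- The exponent `i ≤ q` with `[1 + βF] = dⁱ a_τ d⁻ⁱ`. -/
def expo (τ : S₀) (β : NormFiber c (τ : Fˣ)) : ℕ :=
  (exists_elD_pow_conj_eq hδ τ (α τ) β).choose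

lemma expo_le (τ : S₀) (β : NormFiber c (τ : Fˣ)) : expo hδ α τ β ≤ Nat.card F :=
  (exists_elD_pow_conj_eq hδ τ (α τ) β).choose_spec.1

lemma elD_pow_expo_conj (τ : S₀) (β : NormFiber c (τ : Fˣ)) :
    elD c S₀ δ ^ expo hδ α τ β * oneAdd c S₀ τ (α τ) * (elD c S₀ δ ^ expo hδ α τ β)⁻¹ =
      oneAdd c S₀ τ β :=
  (exists_elD_pow_conj_eq hδ τ (α τ) β).choose_spec.2

lemma rot_expo (τ : S₀) (β : NormFiber c (τ : Fˣ)) : rot (δ ^ expo hδ α τ β) (α τ) = β :=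
  oneAdd_injective τ (by rw [← elD_pow_conj, elD_pow_expo_conj])

/-- The element `Dⁱ A_τ D⁻ⁱ` lying over `[1 + βF]`. -/
def letter (τ : S₀) (β : NormFiber c (τ : Fˣ)) : Q :=
  D ^ expo hδ α τ β * A τ * (D ^ expo hδ α τ β)⁻¹

variable {D S A}

/-- Exponents giving the same point of the norm fiber agree modulo `q + 1`, so `D^(q+1) = 1` already
makes the conjugate depend only on that point. -/
lemma pow_conj_eq_letter (hD : D ^ (Nat.card F + 1) = 1) (n : ℕ) (τ : S₀) :
    D ^ n * A τ * (D ^ n)⁻¹ = letter hδ α D A τ (rot (δ ^ n) (α τ)) := by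
  have h := modEq_of_rot_eq hδ (α τ) (rot_expo hδ α τ (rot (δ ^ n) (α τ)))
  have h' : D ^ expo hδ α τ (rot (δ ^ n) (α τ)) = D ^ n :=
    pow_eq_pow_iff_modEq.2 (h.of_dvd (orderOf_dvd_of_pow_eq_one hD))
  rw [letter, h']

lemma pow_mul_letter (hD : D ^ (Nat.card F + 1) = 1) (n : ℕ) (τ : S₀)
    (β : NormFiber c (τ : Fˣ)) :
    D ^ n * letter hδ α D A τ β * (D ^ n)⁻¹ = letter hδ α D A τ (rot (δ ^ n) β) := by
  conv_rhs => rw [← rot_expo hδ α τ β, ← rot_mul, ← pow_add, ← pow_conj_eq_letter hδ α hD]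
  rw [letter, pow_add]
  group

/-- Conjugation by `D^((q+1)/2)` negates `β`, and the last relation in I says that this conjugation
inverts `A τ`; it commutes with the powers of `D` in a letter. -/
lemma letter_mul_letter_neg (hq : Odd (Nat.card F)) (hD : D ^ (Nat.card F + 1) = 1)
    (hDA : ∀ τ, (D ^ ((Nat.card F + 1) / 2) * A τ) ^ 2 = 1) (τ : S₀)
    (β : NormFiber c (τ : Fˣ)) :
    letter hδ α D A τ β * letter hδ α D A τ β.neg = 1 := by
  set m := (Nat.card F + 1) / 2 with hm
  have hmm : D ^ m * D ^ m = 1 := by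
    obtain ⟨k, hk⟩ := hq
    rw [← pow_add, ← hD]
    congr 1
    omega
  have h1 : (D ^ m)⁻¹ = D ^ m := inv_eq_of_mul_eq_one_right hmm
  have h2 : A τ * (D ^ m * A τ * D ^ m) = 1 := by
    have h := hDA τ
    rw [sq, mul_assoc] at h
    rw [← mul_assoc, eq_inv_of_mul_eq_one_right h, inv_mul_cancel]
  rw [← rot_pow_half hδ hq β, ← pow_mul_letter hδ α hD, ← hm, h1, letter]
  set i := expo hδ α τ β
  have hc : D ^ m * D ^ i = D ^ i * D ^ m := by rw [← pow_add, ← pow_add, add_comm]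
  have hc' : (D ^ i)⁻¹ * D ^ m = D ^ m * (D ^ i)⁻¹ := by
    rw [inv_mul_eq_iff_eq_mul, ← mul_assoc, ← hc, mul_inv_cancel_right]
  calc D ^ i * A τ * (D ^ i)⁻¹ * (D ^ m * (D ^ i * A τ * (D ^ i)⁻¹) * D ^ m)
      = D ^ i * A τ * (D ^ i)⁻¹ * ((D ^ m * D ^ i) * A τ * ((D ^ i)⁻¹ * D ^ m)) := by
        simp only [mul_assoc]
    _ = D ^ i * (A τ * (D ^ m * A τ * D ^ m)) * (D ^ i)⁻¹ := by
        rw [hc, hc']; group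
    _ = 1 := by rw [h2, mul_one, mul_inv_cancel]

/-- A group over `Λ_S` generated by lifts of the generators that satisfy the relations maps
injectively to `Λ_S`. -/
theorem injective_of_relations (hq : Odd (Nat.card F))
    (hgen : Subgroup.closure ({D, S} ∪ Set.range A) = ⊤)
    (hD : D ^ (Nat.card F + 1) = 1) (hS : S ^ 2 = 1) (hSD : (S * D) ^ 2 = 1)
    (hDA : ∀ τ, (D ^ ((Nat.card F + 1) / 2) * A τ) ^ 2 = 1)
    (hSA : ∀ τ, ∃ n : ℕ, S * A τ * S⁻¹ = D ^ n * A τ * (D ^ n)⁻¹)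
    (hsq : ∀ (τ σ : S₀) (h : (τ : Fˣ) ≠ (σ : Fˣ)) (β : NormFiber c (τ : Fˣ))
      (γ : NormFiber c (σ : Fˣ)),
      letter hδ α D A τ β * letter hδ α D A σ γ =
        letter hδ α D A σ (zetaMul h β γ) * letter hδ α D A τ (zetaMul h.symm γ β))
    (φ : Q →* Lam c S₀) (hφD : φ D = elD c S₀ δ) (hφS : φ S = elS c S₀)
    (hφA : ∀ τ, φ (A τ) = oneAdd c S₀ τ (α τ)) : Function.Injective φ := by
  set P := letter hδ α D A with hP
  have hinv := letter_mul_letter_neg hδ α hq hD hDA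
  have hφP : ∀ τ β, φ (P τ β) = oneAdd c S₀ τ β := by
    intro τ β
    rw [hP, letter, map_mul, map_mul, map_inv, map_pow, hφD, hφA, elD_pow_expo_conj]
  set N := Subgroup.closure (⋃ τ : S₀, Set.range (P τ)) with hN
  have hDinv : D⁻¹ = D ^ Nat.card F := by
    rw [inv_eq_iff_mul_eq_one, ← pow_succ', hD]
  have hDN : D ∈ Subgroup.normalizer (N : Set Q) := by
    have key : ∀ n : ℕ, ∀ y ∈ ⋃ τ : S₀, Set.range (P τ),
        D ^ n * y * (D ^ n)⁻¹ ∈ ⋃ τ : S₀, Set.range (P τ) := by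
      intro n y hy
      obtain ⟨τ, β, rfl⟩ := Set.mem_iUnion.1 hy
      exact Set.mem_iUnion.2 ⟨τ, _, (pow_mul_letter hδ α hD n τ β).symm⟩
    refine mem_normalizer_closure (fun y hy => by simpa using key 1 y hy) fun y hy => ?_
    have := key (Nat.card F) y hy
    rwa [← hDinv, inv_inv] at this
  have hSN : S ∈ Subgroup.normalizer (N : Set Q) := by
    have hSi : S⁻¹ = S := inv_eq_self_of_sq_eq_one hS
    have key : ∀ y ∈ ⋃ τ : S₀, Set.range (P τ), S * y * S⁻¹ ∈ ⋃ τ : S₀, Set.range (P τ) := by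
      intro y hy
      obtain ⟨τ, β, rfl⟩ := Set.mem_iUnion.1 hy
      obtain ⟨n, hn⟩ := hSA τ
      -- For `i = expo hδ α τ β`, conjugation by `S` sends `Dⁱ` to `D⁻ⁱ = D^(qi)` and `A τ` to `Dⁿ
      -- A_τ D⁻ⁿ`, whence the exponent `qi + n`.
      refine Set.mem_iUnion.2 ⟨τ, _,
        (pow_conj_eq_letter hδ α hD (Nat.card F * expo hδ α τ β + n) τ).symm.trans ?_⟩
      have h1 : S * D ^ expo hδ α τ β * S⁻¹ = D ^ (Nat.card F * expo hδ α τ β) := by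
        rw [← conj_pow, mul_mul_inv_eq_inv hS hSD, hDinv, ← pow_mul]
      have h2 : S * P τ β * S⁻¹ = (S * D ^ expo hδ α τ β * S⁻¹) * (S * A τ * S⁻¹) *
          (S * D ^ expo hδ α τ β * S⁻¹)⁻¹ := by
        rw [hP, letter]
        group
      rw [h2, h1, hn, pow_add]
      group
    refine mem_normalizer_closure key fun y hy => ?_
    have := key y hy
    rwa [hSi] at this ⊢
  have hAN : ∀ τ, A τ ∈ N := by
    intro τ
    refine Subgroup.subset_closure (Set.mem_iUnion.2 ⟨τ, _,
      (pow_conj_eq_letter hδ α hD 0 τ).symm.trans ?_⟩)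
    simp
  have hnormal : N.Normal := by
    rw [← Subgroup.normalizer_eq_top_iff, eq_top_iff, ← hgen, Subgroup.closure_le]
    rintro x ((rfl | rfl) | ⟨τ, rfl⟩)
    · exact hDN
    · exact hSN
    · exact Subgroup.le_normalizer (hAN τ)
  have htop : N ⊔ Subgroup.closure {D, S} = ⊤ := by
    rw [eq_top_iff, ← hgen, Subgroup.closure_le]
    rintro x (hx | ⟨τ, rfl⟩)
    · exact Subgroup.mem_sup_right (Subgroup.subset_closure hx)
    · exact Subgroup.mem_sup_left (hAN τ)
  rw [injective_iff_map_eq_one]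
  intro x hx
  obtain ⟨ν, hν, b, hb, rfl⟩ := Subgroup.mem_sup_of_normal_left.1
    (show x ∈ N ⊔ Subgroup.closure {D, S} from htop ▸ Subgroup.mem_top x)
  obtain ⟨k, j, rfl⟩ := exists_zpow_mul_pow hS hSD hb
  have hφb : φ (D ^ k * S ^ j) = constHom c S₀ (δ ^ k) * elS c S₀ ^ j := by
    rw [map_mul, map_zpow, map_pow, hφD, hφS, map_zpow]
    rfl
  obtain ⟨u, w, h1, h2, h3⟩ := exists_constHom_mul_elS_pow_eq_cls (S₀ := S₀) (δ ^ k) j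
  -- The image of `b` lies in `Λ_B`, so the word argument kills `ν`. What remains is `D^k S^j`, and
  -- the dihedral relations make it trivial once its image is.
  have hν1 : ν = 1 := eq_one_of_map_mul_cls_eq_one P hinv hsq φ hφP u w h2 h3 hν
    (by rw [← h1, ← hφb, ← map_mul, hx])
  subst hν1
  rw [one_mul] at hx ⊢
  obtain ⟨⟨i, rfl⟩, h5⟩ := even_and_mem_of_constHom_mul_elS_pow_eq_one (hφb.symm.trans hx)
  obtain ⟨r, rfl⟩ := (zpow_mem_baseUnits_iff hδ k).1 h5
  rw [zpow_mul, zpow_natCast, hD, one_zpow, ← two_mul, pow_mul, hS, one_pow, one_mul]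

end PresentationProof

/-! ### The defining relations and the presented group -/

section Main

variable {F : Type*} [Field F] {c : F} [Fact (¬ IsSquare c)] {S₀ : Finset Fˣ} {δ : (FZ c)ˣ}
  (α₀ : S₀ → FZ c) (hα₀ : ∀ τ : S₀, IsBase c δ (τ : Fˣ) (α₀ τ))

/-- The element `α₀` defining `a_τ`, as an element of the norm fiber. -/
def baseFiber (τ : S₀) : NormFiber c (τ : Fˣ) := ⟨α₀ τ, (hα₀ τ).norm_eq⟩

lemma conj_baseFiber_of_isSquare (τ : S₀) (h : IsSquare ((τ : Fˣ) : F)) :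
    (baseFiber α₀ hα₀ τ).conj = baseFiber α₀ hα₀ τ := by
  rcases hα₀ τ with ⟨-, a, -, ha⟩ | ⟨h', -⟩
  · refine Subtype.ext ?_
    change star (α₀ τ) = α₀ τ
    rw [ha]
    ext <;> simp
  · exact absurd h h'

/-- The choice of `α₀` gives `δα₀ = α₁ ∈ F`, so the conjugate of `δα₀/δ̄` is `α₁/δ = α₀`:
conjugation by `sd` fixes `a_τ`. -/
lemma conj_rot_baseFiber_of_not_isSquare (τ : S₀) (h : ¬ IsSquare ((τ : Fˣ) : F)) :
    (rot δ (baseFiber α₀ hα₀ τ)).conj = baseFiber α₀ hα₀ τ := by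
  rcases hα₀ τ with ⟨h', -⟩ | ⟨-, a, -, ha⟩
  · exact absurd h' h
  · refine Subtype.ext ?_
    change star ((δ : FZ c) * α₀ τ / star (δ : FZ c)) = α₀ τ
    have h1 : (δ : FZ c) * α₀ τ = algebraMap F (FZ c) a := by
      rw [ha, mul_comm, mul_assoc, Units.inv_mul, mul_one]
    have h2 : star (algebraMap F (FZ c) a / star (δ : FZ c)) * (δ : FZ c) =
        algebraMap F (FZ c) a := by
      conv_lhs => rw [← star_star (δ : FZ c), ← star_mul', star_star,
        div_mul_cancel₀ _ (star_unit_ne_zero δ)]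
      ext <;> simp
    rw [h1, ha, Units.val_inv_eq_inv_val]
    exact (eq_mul_inv_iff_mul_eq₀ δ.ne_zero).2 h2

lemma lift_word (τ : S₀) (i : ℕ) :
    FreeGroup.lift (genVal c S₀ δ α₀ hα₀) (word S₀ τ i) =
      elD c S₀ δ ^ i * oneAdd c S₀ τ (baseFiber α₀ hα₀ τ) * (elD c S₀ δ ^ i)⁻¹ := by
  simp only [word, wd, wa, map_mul, map_inv, map_pow, FreeGroup.lift_apply_of]
  rfl

variable [Finite F] (hδ : ∀ x : (FZ c)ˣ, x ∈ Subgroup.zpowers δ)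

include hδ in
lemma lift_eq_one_of_mem_rels (hq : Odd (Nat.card F)) {w : FreeGroup (Gen S₀)}
    (hw : w ∈ relsI S₀ ∪ relsII S₀ ∪ relsIII c S₀ δ α₀ hα₀) :
    FreeGroup.lift (genVal c S₀ δ α₀ hα₀) w = 1 := by
  have hs : FreeGroup.lift (genVal c S₀ δ α₀ hα₀) (ws S₀) = elS c S₀ :=
    FreeGroup.lift_apply_of
  have hd : FreeGroup.lift (genVal c S₀ δ α₀ hα₀) (wd S₀) = elD c S₀ δ :=
    FreeGroup.lift_apply_of
  have ha : ∀ τ, FreeGroup.lift (genVal c S₀ δ α₀ hα₀) (wa S₀ τ) =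
      oneAdd c S₀ τ (baseFiber α₀ hα₀ τ) := fun τ => FreeGroup.lift_apply_of
  have hdq : elD c S₀ δ ^ (Nat.card F + 1) = 1 := by
    rw [← orderOf_elD hδ (S₀ := S₀), pow_orderOf_eq_one]
  rcases hw with ((hw | ⟨τ, rfl⟩) | (⟨τ, hτ, rfl⟩ | ⟨τ, hτ, rfl⟩)) |
    ⟨τ, σ, h, α, β, i, j, k, l, h1, h2, h3, h4, rfl⟩
  · rcases hw with rfl | rfl | rfl
    · rw [map_pow, hd, hdq]
    · rw [map_pow, hs, elS_sq]
    · rw [map_pow, map_mul, hs, hd]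
      exact elS_mul_constHom_sq δ
  · rw [map_pow, map_mul, map_pow, hd, ha]
    have h1 := elD_pow_conj δ ((Nat.card F + 1) / 2) τ (baseFiber α₀ hα₀ τ)
    rw [rot_pow_half hδ hq, mul_inv_eq_iff_eq_mul] at h1
    obtain ⟨k, hk⟩ := hq
    have h2 : elD c S₀ δ ^ ((Nat.card F + 1) / 2) * elD c S₀ δ ^ ((Nat.card F + 1) / 2) = 1 := by
      rw [← pow_add, ← hdq]
      congr 1
      omega
    rw [sq]
    nth_rewrite 2 [h1]
    rw [mul_assoc, ← mul_assoc (oneAdd c S₀ τ _), oneAdd_mul_oneAdd_neg, one_mul, h2]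
  · rw [map_mul, map_inv, map_mul, map_mul, hs, ha]
    have h1 := elS_mul_oneAdd τ (baseFiber α₀ hα₀ τ)
    rw [elS_inv, conj_baseFiber_of_isSquare α₀ hα₀ τ hτ] at h1
    rw [h1, mul_inv_cancel]
  · rw [map_mul, map_inv, map_mul, map_mul, map_inv, map_mul, hs, hd, ha]
    have h1 : elS c S₀ * elD c S₀ δ * oneAdd c S₀ τ (baseFiber α₀ hα₀ τ) *
        (elS c S₀ * elD c S₀ δ)⁻¹ = oneAdd c S₀ τ (baseFiber α₀ hα₀ τ) := by
      have h2 := elS_mul_oneAdd τ (rot δ (baseFiber α₀ hα₀ τ))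
      rw [← constHom_mul_oneAdd, conj_rot_baseFiber_of_not_isSquare α₀ hα₀ τ hτ] at h2
      rw [← constHom_apply, mul_inv_rev]
      simpa only [mul_assoc] using h2
    rw [h1, mul_inv_cancel]
  · rw [map_mul, map_inv, map_mul, map_mul, h1.2, h2.2, h3.2, h4.2, oneAdd_mul_oneAdd τ σ h,
      mul_inv_cancel]

include hδ in
theorem closure_range_genVal : Subgroup.closure (Set.range (genVal c S₀ δ α₀ hα₀)) = ⊤ := by
  set H := Subgroup.closure (Set.range (genVal c S₀ δ α₀ hα₀))
  have hd : elD c S₀ δ ∈ H := Subgroup.subset_closure ⟨.d, rfl⟩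
  have hs : elS c S₀ ∈ H := Subgroup.subset_closure ⟨.s, rfl⟩
  have ha : ∀ τ, oneAdd c S₀ τ (baseFiber α₀ hα₀ τ) ∈ H := fun τ =>
    Subgroup.subset_closure ⟨.a τ, rfl⟩
  have hG : Gam c S₀ ≤ H := by
    rw [Gam, Subgroup.closure_le]
    intro g hg
    obtain ⟨τ, β, rfl⟩ := Set.mem_iUnion.1 hg
    obtain ⟨i, -, h⟩ := exists_elD_pow_conj_eq hδ τ (baseFiber α₀ hα₀ τ) β
    rw [← h]
    exact mul_mem (mul_mem (pow_mem hd i) (ha τ)) (inv_mem (pow_mem hd i))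
  rw [eq_top_iff]
  intro g _
  obtain ⟨γ, hγ, e, j, rfl⟩ := exists_eq_mul_constHom_mul_elS_pow
    (fun τ hτ => ⟨baseFiber α₀ hα₀ ⟨τ, hτ⟩⟩) g
  obtain ⟨n, rfl⟩ := hδ e
  refine mul_mem (mul_mem (hG hγ) ?_) (pow_mem hs j)
  simp only [map_zpow]
  exact zpow_mem hd n

-- The free group modulo the relators maps to `Λ_S`, and the kernel is as claimed once this map is
-- injective; the relators supply the hypotheses of `injective_of_relations`.
include hδ in
theorem isPresentation (hq : Odd (Nat.card F)) :
    IsPresentation (genVal c S₀ δ α₀ hα₀)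
      (relsI S₀ ∪ relsII S₀ ∪ relsIII c S₀ δ α₀ hα₀) := by
  refine ⟨closure_range_genVal α₀ hα₀ hδ, ?_⟩
  set rels := relsI S₀ ∪ relsII S₀ ∪ relsIII c S₀ δ α₀ hα₀ with hrels
  set N := Subgroup.normalClosure rels with hN
  have hle : N ≤ (FreeGroup.lift (genVal c S₀ δ α₀ hα₀)).ker :=
    Subgroup.normalClosure_le_normal fun w hw => lift_eq_one_of_mem_rels α₀ hα₀ hδ hq hw
  refine le_antisymm ?_ hle
  let π : FreeGroup (Gen S₀) →* FreeGroup (Gen S₀) ⧸ N := QuotientGroup.mk' N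
  let φ : FreeGroup (Gen S₀) ⧸ N →* Lam c S₀ :=
    QuotientGroup.lift N (FreeGroup.lift (genVal c S₀ δ α₀ hα₀)) hle
  have hφ : ∀ w, φ (π w) = FreeGroup.lift (genVal c S₀ δ α₀ hα₀) w := fun w => rfl
  have hrel : ∀ w ∈ rels, π w = 1 := fun w hw =>
    (QuotientGroup.eq_one_iff w).2 (Subgroup.subset_normalClosure hw)
  have hI : ∀ w ∈ relsI S₀, π w = 1 := fun w hw => hrel w (Or.inl (Or.inl hw))
  have hII : ∀ w ∈ relsII S₀, π w = 1 := fun w hw => hrel w (Or.inl (Or.inr hw))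
  have hS : π (ws S₀) ^ 2 = 1 := by
    rw [← map_pow]; exact hI _ (Or.inl (Or.inr (Or.inl rfl)))
  have hSD : (π (ws S₀) * π (wd S₀)) ^ 2 = 1 := by
    rw [← map_mul, ← map_pow]; exact hI _ (Or.inl (Or.inr (Or.inr rfl)))
  have hSi : (π (ws S₀))⁻¹ = π (ws S₀) := inv_eq_self_of_sq_eq_one hS
  have hinj : Function.Injective φ := by
    refine injective_of_relations hδ (baseFiber α₀ hα₀) (D := π (wd S₀)) (S := π (ws S₀))
      (A := fun τ => π (wa S₀ τ)) hq ?_ ?_ hS hSD ?_ ?_ ?_ φ ?_ ?_ ?_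
    · have h1 : ({π (wd S₀), π (ws S₀)} ∪ Set.range fun τ => π (wa S₀ τ)) =
          π '' Set.range FreeGroup.of := by
        ext x
        constructor
        · rintro ((rfl | rfl) | ⟨τ, rfl⟩)
          · exact ⟨_, ⟨.d, rfl⟩, rfl⟩
          · exact ⟨_, ⟨.s, rfl⟩, rfl⟩
          · exact ⟨_, ⟨.a τ, rfl⟩, rfl⟩
        · rintro ⟨_, ⟨g, rfl⟩, rfl⟩
          cases g with
          | d => exact Or.inl (Or.inl rfl)
          | s => exact Or.inl (Or.inr rfl)
          | a τ => exact Or.inr ⟨τ, rfl⟩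
      rw [h1, ← MonoidHom.map_closure, FreeGroup.closure_range_of, ← MonoidHom.range_eq_map,
        MonoidHom.range_eq_top]
      exact QuotientGroup.mk'_surjective N
    · rw [← map_pow]; exact hI _ (Or.inl (Or.inl rfl))
    · intro τ
      rw [← map_pow, ← map_mul, ← map_pow]
      exact hI _ (Or.inr ⟨τ, rfl⟩)
    · intro τ
      by_cases hτ : IsSquare ((τ : Fˣ) : F)
      · refine ⟨0, ?_⟩
        have h := hII _ (Or.inl ⟨τ, hτ, rfl⟩)
        rw [map_mul, map_inv, mul_inv_eq_one, map_mul, map_mul] at h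
        rw [hSi, pow_zero, one_mul, inv_one, mul_one]
        exact h.symm
      -- Since `sd = d⁻¹s`, the relation `a = (sd)a(sd)⁻¹` becomes `sas⁻¹ = dad⁻¹`.
      · refine ⟨1, ?_⟩
        have h := hII _ (Or.inr ⟨τ, hτ, rfl⟩)
        rw [map_mul, map_inv, mul_inv_eq_one, map_mul, map_mul, map_inv, map_mul] at h
        have h2 : π (ws S₀) * π (wd S₀) = (π (wd S₀))⁻¹ * π (ws S₀) := by
          rw [← mul_inv_eq_iff_eq_mul, mul_mul_inv_eq_inv hS hSD]
        rw [h2] at h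
        rw [pow_one]
        nth_rewrite 2 [h]
        group
    · intro τ σ h β γ
      -- Relations III are imposed for all admissible spellings, in particular for the exponents
      -- chosen by `expo`.
      have hspell : ∀ (ρ : S₀) (ε : NormFiber c (ρ : Fˣ)), Spells c S₀ δ α₀ hα₀ ρ
          (expo hδ (baseFiber α₀ hα₀) ρ ε) ε := fun ρ ε =>
        ⟨expo_le _ _ _ _, by rw [lift_word, elD_pow_expo_conj]⟩
      have h1 := hrel _ (Or.inr ⟨τ, σ, h, β, γ, _, _, _, _, hspell _ _, hspell _ _, hspell _ _,
        hspell _ _, rfl⟩)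
      rw [map_mul, map_inv, mul_inv_eq_one, map_mul, map_mul] at h1
      exact h1
    · rw [hφ]; exact FreeGroup.lift_apply_of
    · rw [hφ]; exact FreeGroup.lift_apply_of
    · intro τ
      rw [hφ]; exact FreeGroup.lift_apply_of
  intro w hw
  rw [← QuotientGroup.eq_one_iff]
  exact (injective_iff_map_eq_one φ).1 hinj (π w) hw

end Main

end QuatLattice

end

theorem corollary2p17 {F : Type*} [Field F] [Finite F] (hq : Odd (Nat.card F))
    (c : F) [Fact (¬ IsSquare c)] (S₀ : Finset Fˣ)
    (δ : (QuatLattice.FZ c)ˣ) (hδ : ∀ x : (QuatLattice.FZ c)ˣ, x ∈ Subgroup.zpowers δ)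
    (α₀ : S₀ → QuatLattice.FZ c)
    (hα₀ : ∀ τ : S₀, QuatLattice.IsBase c δ (τ : Fˣ) (α₀ τ)) :
    -- `Λ_B → Λ_S` is injective and `Λ_S = Γ_S ⋊ Λ_B`, with `Γ_S` of index `2(q+1)`
    Function.Injective (QuatLattice.inclLam c (Finset.empty_subset S₀)) ∧
    (QuatLattice.Gam c S₀).Normal ∧
    Subgroup.IsComplement' (QuatLattice.Gam c S₀) (QuatLattice.LamB c S₀) ∧
    (QuatLattice.Gam c S₀).index = 2 * (Nat.card F + 1) ∧
    -- `PA_τ` is the set of all `dⁱ a_τ d⁻ⁱ` with `0 ≤ i ≤ q`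
    (∀ τ : S₀, QuatLattice.PA c S₀ τ =
      {g | ∃ i : ℕ, i ≤ Nat.card F ∧ g = QuatLattice.elD c S₀ δ ^ i *
        QuatLattice.elA c S₀ δ τ (α₀ τ) (hα₀ τ) * (QuatLattice.elD c S₀ δ ^ i)⁻¹}) ∧
    -- the square relations between elements of `PA_τ` and `PA_σ`
    (∀ (τ σ : S₀) (h : (τ : Fˣ) ≠ (σ : Fˣ)) (α : QuatLattice.NormFiber c (τ : Fˣ))
      (β : QuatLattice.NormFiber c (σ : Fˣ)),
      QuatLattice.oneAdd c S₀ τ α * QuatLattice.oneAdd c S₀ σ β =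
        QuatLattice.oneAdd c S₀ σ (QuatLattice.zetaMul h α β) *
          QuatLattice.oneAdd c S₀ τ (QuatLattice.zetaMul h.symm β α)) ∧
    -- the presentation of `Λ_S`
    QuatLattice.IsPresentation (QuatLattice.genVal c S₀ δ α₀ hα₀)
      (QuatLattice.relsI S₀ ∪ QuatLattice.relsII S₀ ∪ QuatLattice.relsIII c S₀ δ α₀ hα₀) := by
  have hS : ∀ τ ∈ S₀, Nonempty (QuatLattice.NormFiber c τ) := fun τ hτ =>
    ⟨QuatLattice.baseFiber α₀ hα₀ ⟨τ, hτ⟩⟩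
  have hcompl := QuatLattice.isComplement'_Gam_LamB hS
  refine ⟨QuatLattice.inclLam_injective _, QuatLattice.Gam_normal hS, hcompl, ?_, ?_,
    QuatLattice.oneAdd_mul_oneAdd, QuatLattice.isPresentation α₀ hα₀ hδ hq⟩
  · rw [hcompl.symm.index_eq_card, QuatLattice.card_LamB hδ]
  · exact fun τ => QuatLattice.PA_eq hδ τ (QuatLattice.baseFiber α₀ hα₀ τ)
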